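/- Consider the linear system $x_{k+1}=Ax_k+Bu_k+w_k$ with $x_k\in\mathbb R^n$, $u_k\in\mathbb R^m$, and measurements $y_k=Cx_k+v_k\in\mathbb R^p$ for $k\ge 1$, over a finite horizon $T\ge 1$. Here $x_0\sim\mathcal N(\bar x_0,\Sigma_0)$, $w_k\sim\mathcal N(0,Q)$, $v_k\sim\mathcal N(0,R)$, $\delta_k\sim\mathcal N(0,\Sigma_\delta)$ are all mutually independent, with $\Sigma_0,Q,\Sigma_\delta\ge 0$ and $R>0$. For weights $W\ge 0$, $U>0$ let $$\mathcal O_{0:T}=\mathbf E\Big[\sum_{k=0}^{T-1}(x_k'Wx_k+u_k'Uu_k)+x_T'Wx_T\Big].$$ Put $S_T=W$ and, for $0\le k<T$, $\Phi_k=A'S_{k+1}B(B'S_{k+1}B+U)^{-1}B'S_{k+1}A$, $S_k=A'S_{k+1}A+W-\Phi_k$, $L_k=-(B'S_{k+1}B+U)^{-1}B'S_{k+1}A$. Put $P_0=\Sigma_0$ and, for $k\ge 1$, $P_{k|k-1}=AP_{k-1}A'+Q$, $K_k=P_{k|k-1}C'(CP_{k|k-1}C'+R)^{-1}$, $P_k=(I-K_kC)P_{k|k-1}$.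 *Ordinary system.* The server receives $y_k$, computes the Kalman estimate $\hat x_{0|0}=\bar x_0$, $\hat x_{k|k}=\hat x_{k|k-1}+K_k(y_k-C\hat x_{k|k-1})$ with $\hat x_{k|k-1}=A\hat x_{k-1|k-1}+Bu_{k-1}$, and returns $u_k=L_k\hat x_{k|k}$. Let $\mathcal O^\star_{0:T}$ be the optimal value of $\mathcal O_{0:T}$, i.e. its infimum over output-feedback controls, those for which each $u_k$ is a measurable function of $y_1,\dots,y_k$. *Privacy scheme.* The server receives $z_k=y_k+\delta_k$ in place of $y_k$, computes $\hat x^{pub}_{k|k}$ by the same filter (same gains, $\hat x^{pub}_{0|0}=\bar x_0$) with $z_k$ in place of $y_k$, and returns $u_k=L_k\hat x^{pub}_{k|k}$. The true estimate $\hat x_{k|k}$ is given by the filter applied to the true $y_k$ with these inputs $u_k$. Let $\mathcal O_{0:T}$ be the resulting objective and let $$\mathcal Q^k_{privacy}=\mathbf E\big[(\hat x^{pub}_{k|k}-\hat x_{k|k})(\hat x^{pub}_{k|k}-\hat x_{k|k})'\big]$$ be the deviation covariance. Then: 1. Under the privacy scheme, for $0\le k\le T$, almost surely $\hat x_{k|k}=\mathbf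 E[x_k\mid y_1,\dots,y_k,u_0,\dots,u_{k-1}]$ and $P_k=\mathbf E[(x_k-\hat x_{k|k})(x_k-\hat x_{k|k})'\mid y_1,\dots,y_k,u_0,\dots,u_{k-1}]$. 2. The optimal value is attained by the ordinary system's control $u_k=L_k\hat x_{k|k}$, and $$\mathcal O^\star_{0:T}=\mathbf E(x_0'S_0x_0)+\sum_{k=0}^{T-1}\mathrm{tr}(S_{k+1}Q)+\sum_{k=0}^{T-1}\mathrm{tr}(\Phi_kP_k).$$ 3. Under the privacy scheme the cost is integrable and $$\mathcal O_{0:T}=\mathbf E(x_0'S_0x_0)+\sum_{k=0}^{T-1}\mathrm{tr}(S_{k+1}Q)+\sum_{k=0}^{T-1}\mathrm{tr}(\Phi_kP_k)+\sum_{k=0}^{T-1}\mathrm{tr}(\Phi_k\mathcal Q^k_{privacy}).$$ Moreover, for $0\le k<T$, $\mathrm{tr}(\Phi_k\mathcal Q^k_{privacy})=\mathbf E\,\mathrm{tr}\big(\Phi_k\,\mathbf E[(\hat x^{pub}_{k|k}-\hat x_{k|k})(\hat x^{pub}_{k|k}-\hat x_{k|k})'\mid y_1,\dots,y_k]\big)$,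 the latter random variable being integrable. 4. Hence the service loss $\mathcal Q_{LQG}=\frac1T(\mathcal O_{0:T}-\mathcal O^\star_{0:T})$ equals $\frac1T\sum_{k=0}^{T-1}\mathrm{tr}(\Phi_k\mathcal Q^k_{privacy})$. -/

import Mathlib

open MeasureTheory ProbabilityTheory Matrix
open scoped BigOperators

namespace PrivateLQG

noncomputable section

/-- Parameters of the control problem: state dimension `n`, input dimension `m`, measurement
dimension `p`; dynamics `A`, `B`, sensor `C`, noise covariances `Q`, `R`, weights `W`, `U`,
initial mean `x0bar`, initial covariance `Sigma0` and horizon `T`. -/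
structure System (n m p : ℕ) where
  A : Matrix (Fin n) (Fin n) ℝ
  B : Matrix (Fin n) (Fin m) ℝ
  C : Matrix (Fin p) (Fin n) ℝ
  Q : Matrix (Fin n) (Fin n) ℝ
  R : Matrix (Fin p) (Fin p) ℝ
  W : Matrix (Fin n) (Fin n) ℝ
  U : Matrix (Fin m) (Fin m) ℝ
  x0bar : Fin n → ℝ
  Sigma0 : Matrix (Fin n) (Fin n) ℝ
  T : ℕ

namespace System

variable {n m p : ℕ} (s : System n m p)

/-! ### Backward Riccati recursion and control gains -/

/-- `A'SB (B'SB + U)⁻¹ B'SA`. -/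
def phiOf (S : Matrix (Fin n) (Fin n) ℝ) : Matrix (Fin n) (Fin n) ℝ :=
  s.Aᵀ * S * s.B * (s.Bᵀ * S * s.B + s.U)⁻¹ * s.Bᵀ * S * s.A

/-- The Riccati recursion counted from the end: `riccatiRev j` is `S_{T-j}`. -/
def riccatiRev : ℕ → Matrix (Fin n) (Fin n) ℝ
  | 0 => s.W
  | j + 1 => s.Aᵀ * riccatiRev j * s.A + s.W - s.phiOf (riccatiRev j)

/-- `S_k`, for `k ≤ T`. -/
def S (k : ℕ) : Matrix (Fin n) (Fin n) ℝ := s.riccatiRev (s.T - k)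

/-- The gain `L_k = -(B'S_{k+1}B + U)⁻¹ B'S_{k+1}A`, for `k < T`. -/
def L (k : ℕ) : Matrix (Fin m) (Fin n) ℝ :=
  -((s.Bᵀ * s.S (k + 1) * s.B + s.U)⁻¹ * s.Bᵀ * s.S (k + 1) * s.A)

/-- `Φ_k = A'S_{k+1}B (B'S_{k+1}B + U)⁻¹ B'S_{k+1}A`, for `k < T`. -/
def Phi (k : ℕ) : Matrix (Fin n) (Fin n) ℝ := s.phiOf (s.S (k + 1))

/-! ### Kalman filter: covariances and gains -/

/-- `P_{k|k-1}` from `P_{k-1|k-1}`. -/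
def predictCov (P : Matrix (Fin n) (Fin n) ℝ) : Matrix (Fin n) (Fin n) ℝ :=
  s.A * P * s.Aᵀ + s.Q

/-- `K_k` from `P_{k|k-1}`. -/
def gainOf (P : Matrix (Fin n) (Fin n) ℝ) : Matrix (Fin n) (Fin p) ℝ :=
  P * s.Cᵀ * (s.C * P * s.Cᵀ + s.R)⁻¹

/-- The filter covariance `P_k = P_{k|k}`, started at `P_{0|0} = Σ₀`. -/
def P : ℕ → Matrix (Fin n) (Fin n) ℝ
  | 0 => s.Sigma0
  | k + 1 => (1 - s.gainOf (s.predictCov (P k)) * s.C) * s.predictCov (P k)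

/-- `gainSucc k` is the Kalman gain `K_{k+1}` (gains exist from time `1` on). -/
def gainSucc (k : ℕ) : Matrix (Fin n) (Fin p) ℝ := s.gainOf (s.predictCov (s.P k))

/-- One step `(x̂_{k|k}, u_k, y_{k+1}) ↦ x̂_{k+1|k+1}` of the Kalman filter, where
`x̂_{k+1|k} = A x̂_{k|k} + B u_k`. -/
def filterStep (k : ℕ) (e : Fin n → ℝ) (u : Fin m → ℝ) (y : Fin p → ℝ) : Fin n → ℝ :=
  (s.A *ᵥ e + s.B *ᵥ u) + s.gainSucc k *ᵥ (y - s.C *ᵥ (s.A *ᵥ e + s.B *ᵥ u))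

/-! ### State process, measurements and quadratic objective -/

/-- The states `x_k` driven by an input sequence: `x_{k+1} = A x_k + B u_k + w_k`. -/
def state (x0 : Fin n → ℝ) (w : ℕ → Fin n → ℝ) (u : ℕ → Fin m → ℝ) : ℕ → Fin n → ℝ
  | 0 => x0
  | k + 1 => s.A *ᵥ state x0 w u k + s.B *ᵥ u k + w k

/-- `∑_{k<T} (x_k' W x_k + u_k' U u_k) + x_T' W x_T`. -/
def pathCost (x : ℕ → Fin n → ℝ) (u : ℕ → Fin m → ℝ) : ℝ :=
  ∑ k ∈ Finset.range s.T, (x k ⬝ᵥ s.W *ᵥ x k + u k ⬝ᵥ s.U *ᵥ u k) + x s.T ⬝ᵥ s.W *ᵥ x s.T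

end System

/-! ### Noise -/

/-- The sources of randomness: initial state, process noise, sensor noise, injected noise. -/
structure Noise (Ω : Type*) (n p : ℕ) where
  x0 : Ω → Fin n → ℝ
  w : ℕ → Ω → Fin n → ℝ
  v : ℕ → Ω → Fin p → ℝ
  delta : ℕ → Ω → Fin p → ℝ

/-- Labels for the individual random vectors. -/
inductive Source where
  | initial : Source
  | process : ℕ → Source
  | sensor : ℕ → Source
  | injected : ℕ → Source

/-- The dimension of each random vector. -/
def Source.dim (n p : ℕ) : Source → ℕ
  | .initial => n
  | .process _ => n
  | .sensor _ => p
  | .injected _ => p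

namespace Noise

variable {Ω : Type*} {n m p : ℕ}

/-- All the random vectors as one family. -/
def family (N : Noise Ω n p) : (i : Source) → Ω → Fin (i.dim n p) → ℝ
  | .initial => N.x0
  | .process k => N.w k
  | .sensor k => N.v k
  | .injected k => N.delta k

/-- The same randomness with no injected noise. -/
def ordinary (N : Noise Ω n p) : Noise Ω n p := { N with delta := fun _ _ => 0 }

/-- `x₀ ∼ N(x̄₀, Σ₀)`, `w_k ∼ N(0, Q)`, `v_k ∼ N(0, R)`, `δ_k ∼ N(0, Σ_δ)`, all of these
random vectors being mutually independent. -/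
structure IsGaussian [MeasurableSpace Ω] (N : Noise Ω n p) (s : System n m p)
    (SigmaDelta : Matrix (Fin p) (Fin p) ℝ) (μ : Measure Ω) : Prop where
  measurable : ∀ i, Measurable (N.family i)
  law_x0 : HasLaw (fun ω => WithLp.toLp 2 (N.x0 ω))
    (multivariateGaussian (WithLp.toLp 2 s.x0bar) s.Sigma0) μ
  law_w : ∀ k, HasLaw (fun ω => WithLp.toLp 2 (N.w k ω)) (multivariateGaussian 0 s.Q) μ
  law_v : ∀ k, HasLaw (fun ω => WithLp.toLp 2 (N.v k ω)) (multivariateGaussian 0 s.R) μ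
  law_delta : ∀ k, HasLaw (fun ω => WithLp.toLp 2 (N.delta k ω))
    (multivariateGaussian 0 SigmaDelta) μ
  indep : iIndepFun N.family μ

end Noise

/-! ### The closed loop with noise injection -/

/-- The state `x_k`, the public estimate `x̂ᵖᵘᵇ_{k|k}` and the true estimate `x̂_{k|k}`. -/
structure Triple (n : ℕ) where
  x : Fin n → ℝ
  pub : Fin n → ℝ
  est : Fin n → ℝ

variable {Ω : Type*} {n m p : ℕ}

/-- The closed loop: the server receives `z_k = y_k + δ_k` where `y_k = C x_k + v_k`, runs the
Kalman filter on `z_k` and returns `u_k = L_k x̂ᵖᵘᵇ_{k|k}`; the true estimate is the Kalman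
filter run on `y_k` with the same inputs. Both start at `x̄₀`. -/
def loop (s : System n m p) (N : Noise Ω n p) (ω : Ω) : ℕ → Triple n
  | 0 => ⟨N.x0 ω, s.x0bar, s.x0bar⟩
  | k + 1 =>
    let c := loop s N ω k
    let u := s.L k *ᵥ c.pub
    let x := s.A *ᵥ c.x + s.B *ᵥ u + N.w k ω
    let y := s.C *ᵥ x + N.v (k + 1) ω
    let z := y + N.delta (k + 1) ω
    ⟨x, s.filterStep k c.pub u z, s.filterStep k c.est u y⟩

/-- The state `x_k` in the closed loop. -/
def loopState (s : System n m p) (N : Noise Ω n p) (k : ℕ) (ω : Ω) : Fin n → ℝ :=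
  (loop s N ω k).x

/-- The input `u_k = L_k x̂ᵖᵘᵇ_{k|k}` in the closed loop. -/
def loopInput (s : System n m p) (N : Noise Ω n p) (k : ℕ) (ω : Ω) : Fin m → ℝ :=
  s.L k *ᵥ (loop s N ω k).pub

/-- The measurement `y_k = C x_k + v_k` in the closed loop (used for `k ≥ 1`). -/
def loopMeas (s : System n m p) (N : Noise Ω n p) (k : ℕ) (ω : Ω) : Fin p → ℝ :=
  s.C *ᵥ loopState s N k ω + N.v k ω

/-- The true estimate `x̂_{k|k}` in the closed loop. -/
def loopEst (s : System n m p) (N : Noise Ω n p) (k : ℕ) (ω : Ω) : Fin n → ℝ :=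
  (loop s N ω k).est

/-- The deviation `x̂ᵖᵘᵇ_{k|k} - x̂_{k|k}`. -/
def deviation (s : System n m p) (N : Noise Ω n p) (k : ℕ) (ω : Ω) : Fin n → ℝ :=
  (loop s N ω k).pub - (loop s N ω k).est

/-- The objective along one realisation of the closed loop. -/
def loopPathCost (s : System n m p) (N : Noise Ω n p) (ω : Ω) : ℝ :=
  s.pathCost (fun k => loopState s N k ω) (fun k => loopInput s N k ω)

/-- The σ-algebra generated by `y_1, …, y_k` for a measurement process `y`. -/
@[reducible] def sigmaMeas (y : ℕ → Ω → Fin p → ℝ) (k : ℕ) : MeasurableSpace Ω :=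
  ⨆ i ∈ Finset.Icc 1 k, MeasurableSpace.comap (y i) inferInstance

/-- The σ-algebra generated by `y_1, …, y_k` and `u_0, …, u_{k-1}` in the closed loop. -/
@[reducible] def sigmaInfo (s : System n m p) (N : Noise Ω n p) (k : ℕ) : MeasurableSpace Ω :=
  sigmaMeas (loopMeas s N) k ⊔
    ⨆ i ∈ Finset.range k, MeasurableSpace.comap (loopInput s N i) inferInstance

variable [MeasurableSpace Ω]

/-- The LQG objective of the closed loop. -/
def loopCost (s : System n m p) (N : Noise Ω n p) (μ : Measure Ω) : ℝ :=
  ∫ ω, loopPathCost s N ω ∂μ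

/-- The deviation covariance `E[(x̂ᵖᵘᵇ_{k|k} - x̂_{k|k})(x̂ᵖᵘᵇ_{k|k} - x̂_{k|k})']`. -/
def devCov (s : System n m p) (N : Noise Ω n p) (μ : Measure Ω) (k : ℕ) :
    Matrix (Fin n) (Fin n) ℝ :=
  Matrix.of fun i j => ∫ ω, deviation s N k ω i * deviation s N k ω j ∂μ

/-- The conditional deviation covariance given `y_1, …, y_k`, a random matrix. -/
def condDevCov (s : System n m p) (N : Noise Ω n p) (μ : Measure Ω) (k : ℕ) (ω : Ω) :
    Matrix (Fin n) (Fin n) ℝ :=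
  Matrix.of fun i j =>
    (μ[fun ω' => deviation s N k ω' i * deviation s N k ω' j | sigmaMeas (loopMeas s N) k]) ω

/-! ### The optimal value -/

/-- The states driven by an input process `u`. -/
def stateOf (s : System n m p) (N : Noise Ω n p) (u : ℕ → Ω → Fin m → ℝ) (k : ℕ) (ω : Ω) :
    Fin n → ℝ :=
  s.state (N.x0 ω) (fun i => N.w i ω) (fun i => u i ω) k

/-- The measurements of the states driven by `u`. -/
def measOf (s : System n m p) (N : Noise Ω n p) (u : ℕ → Ω → Fin m → ℝ) (k : ℕ) (ω : Ω) :
    Fin p → ℝ :=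
  s.C *ᵥ stateOf s N u k ω + N.v k ω

/-- The objective along one realisation with the input process `u`. -/
def pathCostOf (s : System n m p) (N : Noise Ω n p) (u : ℕ → Ω → Fin m → ℝ) (ω : Ω) : ℝ :=
  s.pathCost (fun k => stateOf s N u k ω) (fun k => u k ω)

/-- Output feedback: each `u_k` is a measurable function of the measurements `y_1, …, y_k` that
`u` itself gives rise to. -/
def IsAdmissible (s : System n m p) (N : Noise Ω n p) (u : ℕ → Ω → Fin m → ℝ) : Prop :=
  ∀ k < s.T, Measurable[sigmaMeas (measOf s N u) k] (u k)

/-- The finite values of the objective attained by output-feedback control. -/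
def admissibleCosts (s : System n m p) (N : Noise Ω n p) (μ : Measure Ω) : Set ℝ :=
  {c | ∃ u : ℕ → Ω → Fin m → ℝ, IsAdmissible s N u ∧ Integrable (pathCostOf s N u) μ ∧
    c = ∫ ω, pathCostOf s N u ω ∂μ}

/-- The optimal objective value over output-feedback control. -/
def optimalCost (s : System n m p) (N : Noise Ω n p) (μ : Measure Ω) : ℝ :=
  sInf (admissibleCosts s N μ)

/-- The service loss `(1/T) (𝒪 - 𝒪⋆)`. -/
def serviceLoss (s : System n m p) (N : Noise Ω n p) (μ : Measure Ω) : ℝ :=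
  (1 / (s.T : ℝ)) * (loopCost s N μ - optimalCost s N μ)

end

end PrivateLQG

open PrivateLQG

/-!
The whole argument rests on the fact that the estimation error `x_k - x̂_{k|k}` obeys a recursion
from which the inputs cancel (`stateOf_eq_estOf_add_filterError`). It can therefore be studied
without reference to any control law. In `filterError_gaussian_and_indep` it is shown by induction
to be `N(0, P_k)` and independent of the σ-algebra `infoAlgebra` generated by the innovations and
the injected noise up to time `k`: at each step fresh independent noise enters, and the Kalman gain
is exactly the matrix which makes the new error uncorrelated with the innovation, so that joint
Gaussianity turns this into independence (`IsCenteredGaussian.kalman_update`).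

For every control law considered, the measurements, estimates and inputs up to time `k` are
measurable with respect to `infoAlgebra`, since a measurement is an innovation plus a function of
earlier estimates and inputs. Conditioning the state on the available information thus removes the
error and keeps the estimate, which gives the conditional mean and covariance.

For the cost, completing the square with the Riccati matrices and telescoping writes the cost of any
square-integrable input process adapted to `infoAlgebra` as an uncontrollable part `baseCost` plus
`∑ E (u_k - L_k x̂_{k|k})' M_k (u_k - L_k x̂_{k|k})` with `M_k = B' S_{k+1} B + U` positive definite
(`pathCostOf_integral`); the cross terms vanish by independence of `w_k` from the past and of the
error from the information. The sum is nonnegative for every output-feedback control, which is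
square-integrable as soon as its cost is finite because `U > 0`; it vanishes for the ordinary loop;
and for the privacy scheme `u_k - L_k x̂_{k|k}` is `L_k` times the deviation, so that
`L_k' M_k L_k = Φ_k` turns the sum into `∑ tr(Φ_k 𝒬ᵏ)`.
-/

namespace PrivateLQG

/-! ### Quadratic forms and completion of the square -/

section QuadraticForms

variable {ι κ : Type*} [Fintype ι] [Fintype κ]

lemma dotProduct_mulVec_comm_of_isSymm {S : Matrix ι ι ℝ} (hS : Sᵀ = S) (x y : ι → ℝ) :
    x ⬝ᵥ S *ᵥ y = y ⬝ᵥ S *ᵥ x := by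
  rw [dotProduct_mulVec, ← mulVec_transpose, hS, dotProduct_comm]

lemma mulVec_dotProduct_eq (A : Matrix ι κ ℝ) (x : κ → ℝ) (y : ι → ℝ) :
    (A *ᵥ x) ⬝ᵥ y = x ⬝ᵥ Aᵀ *ᵥ y := by
  rw [dotProduct_mulVec, vecMul_transpose]

lemma dotProduct_mulVec_self_nonneg {S : Matrix ι ι ℝ} (hS : S.PosSemidef) (x : ι → ℝ) :
    0 ≤ x ⬝ᵥ S *ᵥ x := by
  simpa using hS.dotProduct_mulVec_nonneg x

lemma transpose_eq_of_posSemidef {α : Type*} {S : Matrix α α ℝ} (hS : S.PosSemidef) : Sᵀ = S := by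
  simpa [Matrix.IsHermitian, conjTranspose_eq_transpose_of_trivial] using hS.isHermitian

/-- Cauchy-Schwarz for the form `U`, applied to `u` and `U⁻¹ e_i`. -/
lemma sq_apply_le_of_posDef [DecidableEq ι] {U : Matrix ι ι ℝ} (hU : U.PosDef) (u : ι → ℝ)
    (i : ι) : u i ^ 2 ≤ U⁻¹ i i * (u ⬝ᵥ U *ᵥ u) := by
  have hs : Uᵀ = U := transpose_eq_of_posSemidef hU.posSemidef
  have hβ : 0 < U⁻¹ i i := hU.inv.diag_pos
  have hdet : IsUnit U.det := (Matrix.isUnit_iff_isUnit_det U).1 hU.isUnit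
  set b : ι → ℝ := U⁻¹ *ᵥ Pi.single i 1 with hb
  have hUb : U *ᵥ b = Pi.single i 1 := by
    rw [hb, mulVec_mulVec, Matrix.mul_nonsing_inv _ hdet, one_mulVec]
  have hbi : b i = U⁻¹ i i := by simp [hb]
  have hub : u ⬝ᵥ U *ᵥ b = u i := by rw [hUb]; simp
  have hbb : b ⬝ᵥ U *ᵥ b = U⁻¹ i i := by rw [hUb]; simp [hbi]
  have h0 := dotProduct_mulVec_self_nonneg hU.posSemidef (u - (u i / U⁻¹ i i) • b)
  rw [mulVec_sub, mulVec_smul, dotProduct_sub, sub_dotProduct, sub_dotProduct,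
    dotProduct_smul, smul_dotProduct, smul_dotProduct, dotProduct_smul,
    dotProduct_mulVec_comm_of_isSymm hs b u, hub, hbb] at h0
  simp only [smul_eq_mul] at h0
  have h1 : u ⬝ᵥ U *ᵥ u - u i ^ 2 / U⁻¹ i i ≥ 0 := by
    have : u ⬝ᵥ U *ᵥ u - u i / U⁻¹ i i * u i -
        (u i / U⁻¹ i i * u i - u i / U⁻¹ i i * (u i / U⁻¹ i i * U⁻¹ i i))
        = u ⬝ᵥ U *ᵥ u - u i ^ 2 / U⁻¹ i i := by
      field_simp
      ring
    rw [← this]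
    convert h0 using 2
  have h2 : u i ^ 2 / U⁻¹ i i ≤ u ⬝ᵥ U *ᵥ u := by linarith
  rw [div_le_iff₀ hβ] at h2
  linarith

end QuadraticForms

/-! ### Second moments of random vectors -/

section Moments

variable {Ω : Type*} {mΩ : MeasurableSpace Ω} {μ : Measure Ω}

/-- The matrix `E[X Y']` of cross second moments of two random vectors. -/
noncomputable def crossMoment {ι κ : Type*} (μ : Measure Ω) (X : Ω → ι → ℝ) (Y : Ω → κ → ℝ) :
    Matrix ι κ ℝ :=
  Matrix.of fun i j => ∫ ω, X ω i * Y ω j ∂μ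

lemma crossMoment_transpose {ι κ : Type*} (X : Ω → ι → ℝ) (Y : Ω → κ → ℝ) :
    (crossMoment μ X Y)ᵀ = crossMoment μ Y X := by
  ext i j
  simp [crossMoment, mul_comm]

variable {ι κ τ : Type*} [Fintype ι] [Fintype κ]

lemma measurable_mulVec {α : Type*} {m : MeasurableSpace α} (A : Matrix ι κ ℝ) {X : α → κ → ℝ}
    (hX : Measurable X) : Measurable fun ω => A *ᵥ X ω := by
  have : Continuous fun x : κ → ℝ => A *ᵥ x := continuous_const.matrix_mulVec continuous_id
  exact this.measurable.comp hX

lemma memLp_mulVec (A : Matrix ι κ ℝ) {X : Ω → κ → ℝ} (hX : MemLp X 2 μ) :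
    MemLp (fun ω => A *ᵥ X ω) 2 μ :=
  (LinearMap.toContinuousLinearMap A.mulVecLin).comp_memLp' hX

lemma integrable_apply_mul_apply {X : Ω → ι → ℝ} {Y : Ω → κ → ℝ}
    (hX : MemLp X 2 μ) (hY : MemLp Y 2 μ) (i : ι) (j : κ) :
    Integrable (fun ω => X ω i * Y ω j) μ :=
  (hX.eval i).integrable_mul (hY.eval j)

lemma crossMoment_add_left {X X' : Ω → ι → ℝ} {Y : Ω → κ → ℝ}
    (hX : MemLp X 2 μ) (hX' : MemLp X' 2 μ) (hY : MemLp Y 2 μ) :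
    crossMoment μ (fun ω => X ω + X' ω) Y = crossMoment μ X Y + crossMoment μ X' Y := by
  ext i j
  simp only [crossMoment, of_apply, Pi.add_apply, add_mul, Matrix.add_apply]
  exact integral_add (integrable_apply_mul_apply hX hY i j)
    (integrable_apply_mul_apply hX' hY i j)

lemma crossMoment_add_right {X : Ω → ι → ℝ} {Y Y' : Ω → κ → ℝ}
    (hX : MemLp X 2 μ) (hY : MemLp Y 2 μ) (hY' : MemLp Y' 2 μ) :
    crossMoment μ X (fun ω => Y ω + Y' ω) = crossMoment μ X Y + crossMoment μ X Y' := by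
  rw [← crossMoment_transpose, crossMoment_add_left hY hY' hX, transpose_add,
    crossMoment_transpose, crossMoment_transpose]

lemma crossMoment_mulVec_left (A : Matrix τ ι ℝ) {X : Ω → ι → ℝ} {Y : Ω → κ → ℝ}
    (hX : MemLp X 2 μ) (hY : MemLp Y 2 μ) :
    crossMoment μ (fun ω => A *ᵥ X ω) Y = A * crossMoment μ X Y := by
  ext i j
  simp only [crossMoment, of_apply, mulVec, dotProduct, Matrix.mul_apply, Finset.sum_mul]
  rw [integral_finsetSum]
  · simp only [mul_assoc, integral_const_mul]
  · intro l _
    simp only [mul_assoc]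
    exact (integrable_apply_mul_apply hX hY l j).const_mul _

lemma crossMoment_mulVec_right (A : Matrix τ κ ℝ) {X : Ω → ι → ℝ} {Y : Ω → κ → ℝ}
    (hX : MemLp X 2 μ) (hY : MemLp Y 2 μ) :
    crossMoment μ X (fun ω => A *ᵥ Y ω) = crossMoment μ X Y * Aᵀ := by
  rw [← crossMoment_transpose, crossMoment_mulVec_left A hY hX, transpose_mul,
    crossMoment_transpose]

lemma crossMoment_eq_zero_of_indepFun {X : Ω → ι → ℝ} {Y : Ω → κ → ℝ}
    (h : IndepFun X Y μ) (hX : MemLp X 2 μ) (hY : MemLp Y 2 μ)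
    (hX0 : ∀ i, ∫ ω, X ω i ∂μ = 0) : crossMoment μ X Y = 0 := by
  ext i j
  have hij : IndepFun (fun ω => X ω i) (fun ω => Y ω j) μ :=
    h.comp (measurable_pi_apply i) (measurable_pi_apply j)
  simp only [crossMoment, of_apply, Matrix.zero_apply]
  rw [hij.integral_fun_mul_eq_mul_integral (hX.eval i).1 (hY.eval j).1, hX0, zero_mul]

lemma integrable_dotProduct_mulVec (M : Matrix ι κ ℝ) {X : Ω → ι → ℝ} {Y : Ω → κ → ℝ}
    (hX : MemLp X 2 μ) (hY : MemLp Y 2 μ) : Integrable (fun ω => X ω ⬝ᵥ M *ᵥ Y ω) μ := by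
  simp only [dotProduct]
  exact integrable_finsetSum _ fun i _ =>
    integrable_apply_mul_apply hX (memLp_mulVec M hY) i i

lemma integral_dotProduct_mulVec (M : Matrix ι κ ℝ) {X : Ω → ι → ℝ} {Y : Ω → κ → ℝ}
    (hX : MemLp X 2 μ) (hY : MemLp Y 2 μ) :
    ∫ ω, X ω ⬝ᵥ M *ᵥ Y ω ∂μ = (M * crossMoment μ Y X).trace := by
  rw [← crossMoment_mulVec_left M hY hX]
  simp only [dotProduct, trace, diag_apply, crossMoment, of_apply]
  rw [integral_finsetSum _ fun i _ => integrable_apply_mul_apply hX (memLp_mulVec M hY) i i]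
  simp only [mul_comm]

lemma posSemidef_crossMoment_self {X : Ω → ι → ℝ} (hX : MemLp X 2 μ) :
    (crossMoment μ X X).PosSemidef := by
  refine .of_dotProduct_mulVec_nonneg ?_ fun x => ?_
  · rw [Matrix.IsHermitian, conjTranspose_eq_transpose_of_trivial, crossMoment_transpose]
  · -- `x' E[X X'] x` is the second moment of the scalar `x' X`
    let r : Matrix Unit ι ℝ := Matrix.of fun _ => x
    have h : (r * crossMoment μ X X * rᵀ) () () = x ⬝ᵥ crossMoment μ X X *ᵥ x := by
      rw [Matrix.mul_assoc, Matrix.mul_apply]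
      simp [r, dotProduct, mulVec, Matrix.mul_apply]
    rw [star_trivial, ← h, ← crossMoment_mulVec_left r hX hX,
      ← crossMoment_mulVec_right r (memLp_mulVec r hX) hX]
    exact integral_nonneg fun ω => mul_self_nonneg _

end Moments

/-! ### Independence of σ-algebras -/

section Independence

variable {Ω : Type*} {mΩ : MeasurableSpace Ω} {μ : Measure Ω}

lemma generateFrom_inter_eq_sup {α : Type*} (m₁ m₂ : MeasurableSpace α) :
    m₁ ⊔ m₂ = MeasurableSpace.generateFrom
      {t | ∃ a b, MeasurableSet[m₁] a ∧ MeasurableSet[m₂] b ∧ t = a ∩ b} := by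
  apply le_antisymm
  · refine sup_le (fun a ha => ?_) fun b hb => ?_
    · exact MeasurableSpace.measurableSet_generateFrom
        ⟨a, Set.univ, ha, @MeasurableSet.univ _ m₂, (Set.inter_univ a).symm⟩
    · exact MeasurableSpace.measurableSet_generateFrom
        ⟨Set.univ, b, @MeasurableSet.univ _ m₁, hb, (Set.univ_inter b).symm⟩
  · refine MeasurableSpace.generateFrom_le ?_
    rintro _ ⟨a, b, ha, hb, rfl⟩
    exact @MeasurableSet.inter _ (m₁ ⊔ m₂) _ _ (le_sup_left (b := m₂) _ ha)
      (le_sup_right (a := m₁) _ hb)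

lemma isPiSystem_inter_measurableSet {α : Type*} (m₁ m₂ : MeasurableSpace α) :
    IsPiSystem {t | ∃ a b, MeasurableSet[m₁] a ∧ MeasurableSet[m₂] b ∧ t = a ∩ b} := by
  rintro _ ⟨a, b, ha, hb, rfl⟩ _ ⟨c, d, hc, hd, rfl⟩ -
  exact ⟨a ∩ c, b ∩ d, @MeasurableSet.inter _ m₁ _ _ ha hc, @MeasurableSet.inter _ m₂ _ _ hb hd,
    Set.inter_inter_inter_comm _ _ _ _⟩

/-- Independence is kept when two independent pairs, independent of each other, are regrouped. -/
lemma indep_sup_sup [IsProbabilityMeasure μ] {m₁ m₂ m₃ m₄ : MeasurableSpace Ω}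
    (h₁ : m₁ ≤ mΩ) (h₂ : m₂ ≤ mΩ) (h₃ : m₃ ≤ mΩ) (h₄ : m₄ ≤ mΩ)
    (h₁₂ : Indep m₁ m₂ μ) (h₃₄ : Indep m₃ m₄ μ) (h : Indep (m₁ ⊔ m₂) (m₃ ⊔ m₄) μ) :
    Indep (m₁ ⊔ m₃) (m₂ ⊔ m₄) μ := by
  refine IndepSets.indep (sup_le h₁ h₃) (sup_le h₂ h₄)
    (isPiSystem_inter_measurableSet m₁ m₃) (isPiSystem_inter_measurableSet m₂ m₄)
    (generateFrom_inter_eq_sup _ _) (generateFrom_inter_eq_sup _ _) ?_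
  rw [IndepSets_iff]
  rintro _ _ ⟨a, c, ha, hc, rfl⟩ ⟨b, d, hb, hd, rfl⟩
  rw [Indep_iff] at h₁₂ h₃₄ h
  have ha' : MeasurableSet[m₁ ⊔ m₂] a := le_sup_left (b := m₂) _ ha
  have hb' : MeasurableSet[m₁ ⊔ m₂] b := le_sup_right (a := m₁) _ hb
  have hc' : MeasurableSet[m₃ ⊔ m₄] c := le_sup_left (b := m₄) _ hc
  have hd' : MeasurableSet[m₃ ⊔ m₄] d := le_sup_right (a := m₃) _ hd
  rw [Set.inter_inter_inter_comm, h _ _ (@MeasurableSet.inter _ (m₁ ⊔ m₂) _ _ ha' hb')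
    (@MeasurableSet.inter _ (m₃ ⊔ m₄) _ _ hc' hd'), h₁₂ _ _ ha hb, h₃₄ _ _ hc hd,
    h _ _ ha' hc', h _ _ hb' hd']
  ring

lemma indep_sup_right [IsProbabilityMeasure μ] {m₁ m₂ m₃ : MeasurableSpace Ω}
    (h₁ : m₁ ≤ mΩ) (h₂ : m₂ ≤ mΩ) (h₃ : m₃ ≤ mΩ)
    (h₁₂ : Indep m₁ m₂ μ) (h : Indep (m₁ ⊔ m₂) m₃ μ) : Indep m₁ (m₂ ⊔ m₃) μ := by
  have := indep_sup_sup h₁ h₂ bot_le h₃ h₁₂ (indep_bot_left m₃) (by rwa [bot_sup_eq])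
  rwa [sup_bot_eq] at this

end Independence

/-! ### Centred Gaussian vectors and the update step of the Kalman filter -/

section CenteredGaussian

variable {Ω : Type*} {mΩ : MeasurableSpace Ω} {μ : Measure Ω}
variable {ι κ : Type*} [Fintype ι] [Fintype κ]

/-- `X ∼ N(0, S)`, expressed by Gaussianity together with the first two moments. -/
structure IsCenteredGaussian (X : Ω → ι → ℝ) (S : Matrix ι ι ℝ) (μ : Measure Ω) : Prop where
  gaussian : HasGaussianLaw X μ
  mean : ∀ i, ∫ ω, X ω i ∂μ = 0
  moment : crossMoment μ X X = S

lemma IsCenteredGaussian.memLp {X : Ω → ι → ℝ} {S : Matrix ι ι ℝ}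
    (hX : IsCenteredGaussian X S μ) : MemLp X 2 μ := hX.gaussian.memLp_two

lemma integral_mulVec_add_eq_zero (A : Matrix ι κ ℝ) {X : Ω → κ → ℝ} {Y : Ω → ι → ℝ}
    (hX : Integrable X μ) (hY : Integrable Y μ) (hX0 : ∀ i, ∫ ω, X ω i ∂μ = 0)
    (hY0 : ∀ i, ∫ ω, Y ω i ∂μ = 0) (i : ι) : ∫ ω, (A *ᵥ X ω + Y ω) i ∂μ = 0 := by
  simp only [Pi.add_apply, mulVec, dotProduct]
  rw [integral_add (integrable_finsetSum _ fun j _ => (hX.eval j).const_mul _) (hY.eval i),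
    integral_finsetSum _ fun j _ => (hX.eval j).const_mul _, hY0]
  simp [integral_const_mul, hX0]

lemma isCenteredGaussian_sub_of_hasLaw [DecidableEq ι] {X : Ω → ι → ℝ} {m : ι → ℝ}
    {S : Matrix ι ι ℝ} (hS : S.PosSemidef)
    (hX : HasLaw (fun ω => WithLp.toLp 2 (X ω)) (multivariateGaussian (WithLp.toLp 2 m) S) μ) :
    IsCenteredGaussian (fun ω => X ω - m) S μ := by
  have : IsProbabilityMeasure μ := hX.isProbabilityMeasure
  have hg : HasGaussianLaw X μ :=
    hX.hasGaussianLaw.map_equiv (PiLp.continuousLinearEquiv 2 ℝ fun _ : ι => ℝ)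
  have hmean (i : ι) : ∫ ω, X ω i ∂μ = m i := by
    have h1 := hX.integral_eq
    rw [integral_id_multivariateGaussian] at h1
    have h2 := (EuclideanSpace.proj (𝕜 := ℝ) i).integral_comp_comm
      hX.hasGaussianLaw.integrable
    rw [h1] at h2
    simpa using h2
  refine ⟨⟨?_⟩, fun i => ?_, ?_⟩
  · have := hg.isGaussian_map
    have h3 : μ.map (fun ω => X ω - m) = (μ.map X).map (fun x => x + -m) := by
      rw [AEMeasurable.map_map_of_aemeasurable (by fun_prop) hg.aemeasurable]
      simp [Function.comp_def, sub_eq_add_neg]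
    rw [h3]
    infer_instance
  · simp only [Pi.sub_apply]
    rw [integral_sub (hg.integrable.eval i) (integrable_const _), hmean]
    simp
  · ext i j
    have h4 := hX.covariance_fun_comp (f := fun x => x i) (g := fun x => x j)
      (by fun_prop) (by fun_prop)
    rw [covariance_eval_multivariateGaussian hS] at h4
    rw [← h4]
    simp [crossMoment, covariance, hmean]

lemma isCenteredGaussian_of_hasLaw [DecidableEq ι] {X : Ω → ι → ℝ}
    {S : Matrix ι ι ℝ} (hS : S.PosSemidef)
    (hX : HasLaw (fun ω => WithLp.toLp 2 (X ω)) (multivariateGaussian 0 S) μ) :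
    IsCenteredGaussian X S μ := by
  simpa using isCenteredGaussian_sub_of_hasLaw (m := 0) hS (by simpa using hX)

lemma IsCenteredGaussian.mulVec_add {X : Ω → κ → ℝ} {Y : Ω → ι → ℝ} {S : Matrix κ κ ℝ}
    {Q : Matrix ι ι ℝ} (hX : IsCenteredGaussian X S μ) (hY : IsCenteredGaussian Y Q μ)
    (hXY : IndepFun X Y μ) (A : Matrix ι κ ℝ) :
    IsCenteredGaussian (fun ω => A *ᵥ X ω + Y ω) (A * S * Aᵀ + Q) μ := by
  have hA := memLp_mulVec A hX.memLp
  have hAY : MemLp (fun ω => A *ᵥ X ω + Y ω) 2 μ := hA.add hY.memLp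
  have h0 : crossMoment μ X Y = 0 :=
    crossMoment_eq_zero_of_indepFun hXY hX.memLp hY.memLp hX.mean
  have h0' : crossMoment μ Y X = 0 := by rw [← crossMoment_transpose, h0, transpose_zero]
  refine ⟨?_, integral_mulVec_add_eq_zero A hX.gaussian.integrable hY.gaussian.integrable
    hX.mean hY.mean, ?_⟩
  · exact (hXY.hasGaussianLaw hX.gaussian hY.gaussian).map_fun (LinearMap.toContinuousLinearMap
      (A.mulVecLin ∘ₗ LinearMap.fst ℝ _ _ + LinearMap.snd ℝ _ _))
  · rw [crossMoment_add_left hA hY.memLp hAY,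
      crossMoment_add_right hA hA hY.memLp, crossMoment_add_right hY.memLp hA hY.memLp,
      crossMoment_mulVec_left A hX.memLp hA, crossMoment_mulVec_right A hX.memLp hX.memLp,
      crossMoment_mulVec_left A hX.memLp hY.memLp,
      crossMoment_mulVec_right A hY.memLp hX.memLp, h0, h0', hX.moment, hY.moment]
    simp [Matrix.mul_assoc]

/-- The update step of the Kalman filter: the gain `K = Σ C' (C Σ C' + R)⁻¹` makes the error
`X - K ν` uncorrelated with, hence (by joint Gaussianity) independent of, the innovation
`ν = C X + V`. -/
lemma IsCenteredGaussian.kalman_update [DecidableEq ι] [DecidableEq κ] {X : Ω → ι → ℝ}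
    {V : Ω → κ → ℝ} {S : Matrix ι ι ℝ} {R : Matrix κ κ ℝ} (hX : IsCenteredGaussian X S μ)
    (hV : IsCenteredGaussian V R μ) (hXV : IndepFun X V μ) (hR : R.PosDef) (C : Matrix κ ι ℝ)
    {K : Matrix ι κ ℝ} (hK : K = S * Cᵀ * (C * S * Cᵀ + R)⁻¹) :
    IsCenteredGaussian (fun ω => X ω - K *ᵥ (C *ᵥ X ω + V ω)) ((1 - K * C) * S) μ ∧
      IndepFun (fun ω => X ω - K *ᵥ (C *ᵥ X ω + V ω)) (fun ω => C *ᵥ X ω + V ω) μ := by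
  have : IsProbabilityMeasure μ := hX.gaussian.isProbabilityMeasure
  have hν := hX.mulVec_add hV hXV C
  have hS : S.PosSemidef := hX.moment ▸ posSemidef_crossMoment_self hX.memLp
  have hdet : IsUnit (C * S * Cᵀ + R).det := by
    rw [← Matrix.isUnit_iff_isUnit_det]
    refine (Matrix.PosDef.posSemidef_add ?_ hR).isUnit
    simpa [conjTranspose_eq_transpose_of_trivial] using hS.mul_mul_conjTranspose_same C
  have hXV0 : crossMoment μ X V = 0 :=
    crossMoment_eq_zero_of_indepFun hXV hX.memLp hV.memLp hX.mean
  have hXν : crossMoment μ X (fun ω => C *ᵥ X ω + V ω) = S * Cᵀ := by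
    rw [crossMoment_add_right hX.memLp (memLp_mulVec C hX.memLp) hV.memLp,
      crossMoment_mulVec_right C hX.memLp hX.memLp, hX.moment, hXV0, add_zero]
  have hνX : crossMoment μ (fun ω => C *ᵥ X ω + V ω) X = C * S := by
    rw [← crossMoment_transpose, hXν, transpose_mul, transpose_transpose,
      transpose_eq_of_posSemidef hS]
  have hKν := memLp_mulVec (-K) hν.memLp
  have hsub : (fun ω => X ω - K *ᵥ (C *ᵥ X ω + V ω)) =
      fun ω => X ω + (-K) *ᵥ (C *ᵥ X ω + V ω) := by
    funext ω
    rw [neg_mulVec, sub_eq_add_neg]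
  rw [hsub]
  have hE : MemLp (fun ω => X ω + (-K) *ᵥ (C *ᵥ X ω + V ω)) 2 μ := hX.memLp.add hKν
  have hEν : crossMoment μ (fun ω => X ω + (-K) *ᵥ (C *ᵥ X ω + V ω))
      (fun ω => C *ᵥ X ω + V ω) = 0 := by
    rw [crossMoment_add_left hX.memLp hKν hν.memLp, hXν,
      crossMoment_mulVec_left (-K) hν.memLp hν.memLp, hν.moment, hK, Matrix.neg_mul,
      Matrix.nonsing_inv_mul_cancel_right _ _ hdet, add_neg_cancel]
  have hEE : crossMoment μ (fun ω => X ω + (-K) *ᵥ (C *ᵥ X ω + V ω))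
      (fun ω => X ω + (-K) *ᵥ (C *ᵥ X ω + V ω)) = (1 - K * C) * S := by
    rw [crossMoment_add_right hE hX.memLp hKν, crossMoment_mulVec_right (-K) hE hν.memLp, hEν,
      Matrix.zero_mul, add_zero, crossMoment_add_left hX.memLp hKν hX.memLp, hX.moment,
      crossMoment_mulVec_left (-K) hν.memLp hX.memLp, hνX, Matrix.sub_mul, Matrix.one_mul,
      Matrix.neg_mul, Matrix.mul_assoc, sub_eq_add_neg]
  have hEmean (i : ι) : ∫ ω, (X ω + (-K) *ᵥ (C *ᵥ X ω + V ω)) i ∂μ = 0 := by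
    have := integral_mulVec_add_eq_zero (-K) hν.gaussian.integrable hX.gaussian.integrable
      hν.mean hX.mean i
    simpa only [add_comm] using this
  have hjoint : HasGaussianLaw
      (fun ω => (X ω + (-K) *ᵥ (C *ᵥ X ω + V ω), C *ᵥ X ω + V ω)) μ := by
    let T : (ι → ℝ) × (κ → ℝ) →ₗ[ℝ] (κ → ℝ) :=
      C.mulVecLin ∘ₗ LinearMap.fst ℝ _ _ + LinearMap.snd ℝ _ _
    exact (hXV.hasGaussianLaw hX.gaussian hV.gaussian).map_fun (LinearMap.toContinuousLinearMap
      ((LinearMap.fst ℝ _ _ + (-K).mulVecLin ∘ₗ T).prod T))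
  refine ⟨⟨hjoint.fst, hEmean, hEE⟩, ?_⟩
  refine HasGaussianLaw.indepFun_of_covariance_eval (X := fun i ω => _) (Y := fun j ω => _)
    hjoint fun i j => ?_
  have h := congrFun (congrFun hEν i) j
  rw [covariance]
  simp only [hEmean, hν.mean, sub_zero]
  exact h

end CenteredGaussian

/-! ### The backward Riccati recursion -/

namespace System

variable {n m p : ℕ} {s : System n m p}

/-- The weight `B' S_{k+1} B + U` of the input at time `k` once the square is completed. -/
noncomputable def inputWeight (s : System n m p) (k : ℕ) : Matrix (Fin m) (Fin m) ℝ :=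
  s.Bᵀ * s.S (k + 1) * s.B + s.U

lemma S_horizon (s : System n m p) : s.S s.T = s.W := by
  simp [S, riccatiRev]

lemma S_eq (s : System n m p) {k : ℕ} (hk : k < s.T) :
    s.S k = s.Aᵀ * s.S (k + 1) * s.A + s.W - s.Phi k := by
  obtain ⟨j, hj⟩ : ∃ j, s.T - k = j + 1 := ⟨s.T - k - 1, by omega⟩
  have hj' : s.T - (k + 1) = j := by omega
  simp only [S, Phi, hj, hj', riccatiRev]

lemma posDef_inputWeight_of_posSemidef (hU : s.U.PosDef) {k : ℕ} (hS : (s.S (k + 1)).PosSemidef) :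
    (s.inputWeight k).PosDef := by
  refine Matrix.PosDef.posSemidef_add ?_ hU
  simpa [conjTranspose_eq_transpose_of_trivial] using hS.conjTranspose_mul_mul_same s.B

lemma inputWeight_mul_L (hU : s.U.PosDef) {k : ℕ} (hS : (s.S (k + 1)).PosSemidef) :
    s.inputWeight k * s.L k = -(s.Bᵀ * s.S (k + 1) * s.A) := by
  have hdet := (Matrix.isUnit_iff_isUnit_det _).1
    (posDef_inputWeight_of_posSemidef hU hS).isUnit
  rw [L, ← inputWeight, Matrix.mul_neg]
  simp only [Matrix.mul_assoc]
  rw [← Matrix.mul_assoc, Matrix.mul_nonsing_inv _ hdet, Matrix.one_mul]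

lemma L_transpose_mul_inputWeight_mul_L (hU : s.U.PosDef) {k : ℕ}
    (hS : (s.S (k + 1)).PosSemidef) :
    (s.L k)ᵀ * s.inputWeight k * s.L k = s.Phi k := by
  have hM := transpose_eq_of_posSemidef (posDef_inputWeight_of_posSemidef hU hS).posSemidef
  rw [Matrix.mul_assoc, inputWeight_mul_L hU hS, L, ← inputWeight, transpose_neg, Matrix.neg_mul,
    Matrix.mul_neg, neg_neg, Phi, phiOf, ← inputWeight]
  simp only [transpose_mul, transpose_transpose, transpose_nonsing_inv, hM,
    transpose_eq_of_posSemidef hS, Matrix.mul_assoc]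

lemma dotProduct_inputWeight_L (hU : s.U.PosDef) {k : ℕ} (hS : (s.S (k + 1)).PosSemidef)
    (x : Fin n → ℝ) :
    (s.L k *ᵥ x) ⬝ᵥ s.inputWeight k *ᵥ (s.L k *ᵥ x) = x ⬝ᵥ s.Phi k *ᵥ x := by
  rw [mulVec_dotProduct_eq, mulVec_mulVec, mulVec_mulVec,
    L_transpose_mul_inputWeight_mul_L hU hS]

/-- Completion of the square in one step of the Riccati recursion. -/
lemma riccati_complete_square (hU : s.U.PosDef) {k : ℕ} (hk : k < s.T)
    (hS : (s.S (k + 1)).PosSemidef) (x : Fin n → ℝ) (u : Fin m → ℝ) :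
    x ⬝ᵥ s.W *ᵥ x + u ⬝ᵥ s.U *ᵥ u
        + (s.A *ᵥ x + s.B *ᵥ u) ⬝ᵥ s.S (k + 1) *ᵥ (s.A *ᵥ x + s.B *ᵥ u)
      = x ⬝ᵥ s.S k *ᵥ x
        + (u - s.L k *ᵥ x) ⬝ᵥ s.inputWeight k *ᵥ (u - s.L k *ᵥ x) := by
  have hsymm := transpose_eq_of_posSemidef hS
  have hM := transpose_eq_of_posSemidef (posDef_inputWeight_of_posSemidef hU hS).posSemidef
  have h1 : u ⬝ᵥ s.inputWeight k *ᵥ (s.L k *ᵥ x)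
      = -((s.B *ᵥ u) ⬝ᵥ s.S (k + 1) *ᵥ (s.A *ᵥ x)) := by
    rw [mulVec_mulVec, inputWeight_mul_L hU hS, mulVec_dotProduct_eq, neg_mulVec, dotProduct_neg,
      mulVec_mulVec, mulVec_mulVec, Matrix.mul_assoc]
  have h2 : u ⬝ᵥ s.inputWeight k *ᵥ u
      = (s.B *ᵥ u) ⬝ᵥ s.S (k + 1) *ᵥ (s.B *ᵥ u) + u ⬝ᵥ s.U *ᵥ u := by
    rw [inputWeight, add_mulVec, dotProduct_add, mulVec_dotProduct_eq, mulVec_mulVec,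
      mulVec_mulVec, Matrix.mul_assoc]
  have h3 : x ⬝ᵥ s.S k *ᵥ x = (s.A *ᵥ x) ⬝ᵥ s.S (k + 1) *ᵥ (s.A *ᵥ x) + x ⬝ᵥ s.W *ᵥ x
      - x ⬝ᵥ s.Phi k *ᵥ x := by
    rw [S_eq s hk, sub_mulVec, add_mulVec, dotProduct_sub, dotProduct_add, mulVec_dotProduct_eq,
      mulVec_mulVec, mulVec_mulVec, Matrix.mul_assoc]
  have h4 := dotProduct_inputWeight_L hU hS x
  rw [h3]
  simp only [mulVec_add, mulVec_sub, add_dotProduct, sub_dotProduct, dotProduct_add,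
    dotProduct_sub]
  rw [dotProduct_mulVec_comm_of_isSymm hM (s.L k *ᵥ x) u, h1, h2, h4,
    dotProduct_mulVec_comm_of_isSymm hsymm (s.A *ᵥ x) (s.B *ᵥ u)]
  ring

lemma posSemidef_S (hW : s.W.PosSemidef) (hU : s.U.PosDef) {k : ℕ} (hk : k ≤ s.T) :
    (s.S k).PosSemidef := by
  induction hk using Nat.decreasingInduction with
  | self => rw [S_horizon]; exact hW
  | of_succ k hk hS =>
    have hM := posDef_inputWeight_of_posSemidef hU hS
    have hPhi : (s.Phi k)ᵀ = s.Phi k := by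
      rw [← L_transpose_mul_inputWeight_mul_L hU hS]
      simp only [transpose_mul, transpose_transpose, Matrix.mul_assoc,
        transpose_eq_of_posSemidef hM.posSemidef]
    refine .of_dotProduct_mulVec_nonneg ?_ fun x => ?_
    · rw [Matrix.IsHermitian, conjTranspose_eq_transpose_of_trivial, S_eq s hk]
      simp only [transpose_sub, transpose_add, transpose_mul, transpose_transpose, hPhi,
        transpose_eq_of_posSemidef hW, transpose_eq_of_posSemidef hS, Matrix.mul_assoc]
    · -- at `u = L_k x` the square vanishes, and `x' S_k x` is a sum of nonnegative costs
      have h := riccati_complete_square hU hk hS x (s.L k *ᵥ x)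
      rw [sub_self, zero_dotProduct, add_zero] at h
      rw [star_trivial, ← h]
      have h1 := dotProduct_mulVec_self_nonneg hW x
      have h2 := dotProduct_mulVec_self_nonneg hU.posSemidef (s.L k *ᵥ x)
      have h3 := dotProduct_mulVec_self_nonneg hS (s.A *ᵥ x + s.B *ᵥ (s.L k *ᵥ x))
      positivity

lemma posDef_inputWeight (hW : s.W.PosSemidef) (hU : s.U.PosDef) {k : ℕ} (hk : k < s.T) :
    (s.inputWeight k).PosDef :=
  posDef_inputWeight_of_posSemidef hU (posSemidef_S hW hU hk)

end System

/-! ### Estimation error, innovations and the information they carry -/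

section Filter

variable {Ω : Type*} {n m p : ℕ}

/-- The error `x_k - x̂_{k|k}` of the Kalman filter. It obeys a recursion in which the inputs
cancel, so it is defined from the noise alone. -/
noncomputable def filterError (s : System n m p) (N : Noise Ω n p) : ℕ → Ω → Fin n → ℝ
  | 0 => fun ω => N.x0 ω - s.x0bar
  | k + 1 => fun ω =>
    s.A *ᵥ filterError s N k ω + N.w k ω
      - s.gainSucc k *ᵥ (s.C *ᵥ (s.A *ᵥ filterError s N k ω + N.w k ω) + N.v (k + 1) ω)

/-- The innovation `y_{k+1} - C x̂_{k+1|k}`, again free of the inputs. -/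
noncomputable def innovation (s : System n m p) (N : Noise Ω n p) (k : ℕ) (ω : Ω) : Fin p → ℝ :=
  s.C *ᵥ (s.A *ᵥ filterError s N k ω + N.w k ω) + N.v (k + 1) ω

/-- The σ-algebra generated by the innovations and the injected noise up to time `k`; it contains
everything the controller may know at time `k`, whatever the inputs. -/
@[reducible] noncomputable def infoAlgebra (s : System n m p) (N : Noise Ω n p) : ℕ → MeasurableSpace Ω
  | 0 => ⊥
  | k + 1 => infoAlgebra s N k ⊔
      (MeasurableSpace.comap (innovation s N k) inferInstance ⊔
        MeasurableSpace.comap (N.delta (k + 1)) inferInstance)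

/-- The random vectors drawn up to time `k`, as a set of labels. -/
def pastSources (k : ℕ) : Set Source :=
  {i | match i with
    | .initial => True
    | .process j => j < k
    | .sensor j => j ≤ k
    | .injected j => j ≤ k}

/-- The σ-algebra generated by a set of sources of randomness. -/
@[reducible] def sourceAlgebra (N : Noise Ω n p) (I : Set Source) : MeasurableSpace Ω :=
  ⨆ i ∈ I, MeasurableSpace.comap (N.family i) inferInstance

lemma sourceAlgebra_mono (N : Noise Ω n p) {I J : Set Source} (h : I ⊆ J) :
    sourceAlgebra N I ≤ sourceAlgebra N J :=
  biSup_mono h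

lemma comap_family_le_sourceAlgebra (N : Noise Ω n p) {I : Set Source} {i : Source} (hi : i ∈ I) :
    MeasurableSpace.comap (N.family i) inferInstance ≤ sourceAlgebra N I :=
  le_biSup (fun i => MeasurableSpace.comap (N.family i) inferInstance) hi

lemma measurable_family_sourceAlgebra (N : Noise Ω n p) {I : Set Source} {i : Source}
    (hi : i ∈ I) : Measurable[sourceAlgebra N I] (N.family i) :=
  Measurable.of_comap_le (comap_family_le_sourceAlgebra N hi)

lemma pastSources_subset_succ (k : ℕ) : pastSources k ⊆ pastSources (k + 1) := by
  rintro (_ | j | j | j) h <;> simp_all [pastSources] <;> omega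

lemma measurable_predictionError {s : System n m p} {N : Noise Ω n p} {k : ℕ}
    {𝓖 : MeasurableSpace Ω} (he : Measurable[𝓖] (filterError s N k))
    (hw : Measurable[𝓖] (N.w k)) :
    Measurable[𝓖] fun ω => s.A *ᵥ filterError s N k ω + N.w k ω :=
  (measurable_mulVec s.A he).add hw

lemma measurable_innovation {s : System n m p} {N : Noise Ω n p} {k : ℕ}
    {𝓖 : MeasurableSpace Ω} (he : Measurable[𝓖] (filterError s N k))
    (hw : Measurable[𝓖] (N.w k)) (hv : Measurable[𝓖] (N.v (k + 1))) :
    Measurable[𝓖] (innovation s N k) :=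
  (measurable_mulVec s.C (measurable_predictionError he hw)).add hv

lemma measurable_filterError_succ {s : System n m p} {N : Noise Ω n p} {k : ℕ}
    {𝓖 : MeasurableSpace Ω} (he : Measurable[𝓖] (filterError s N k))
    (hw : Measurable[𝓖] (N.w k)) (hv : Measurable[𝓖] (N.v (k + 1))) :
    Measurable[𝓖] (filterError s N (k + 1)) :=
  (measurable_predictionError he hw).sub
    (measurable_mulVec (s.gainSucc k) (measurable_innovation he hw hv))

lemma measurable_filterError_pastSources (s : System n m p) (N : Noise Ω n p) (k : ℕ) :
    Measurable[sourceAlgebra N (pastSources k)] (filterError s N k) := by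
  induction k with
  | zero =>
    have h : Measurable[sourceAlgebra N (pastSources 0)] N.x0 :=
      measurable_family_sourceAlgebra N (i := .initial) (by simp [pastSources])
    exact Measurable.sub h (@measurable_const _ _ _ (sourceAlgebra N (pastSources 0)) _)
  | succ k ih =>
    refine measurable_filterError_succ
      (ih.mono (sourceAlgebra_mono N (pastSources_subset_succ k)) le_rfl) ?_ ?_
    · exact measurable_family_sourceAlgebra N (i := .process k) (by simp [pastSources])
    · exact measurable_family_sourceAlgebra N (i := .sensor (k + 1)) (by simp [pastSources])

lemma infoAlgebra_le_pastSources (s : System n m p) (N : Noise Ω n p) (k : ℕ) :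
    infoAlgebra s N k ≤ sourceAlgebra N (pastSources k) := by
  induction k with
  | zero => exact bot_le
  | succ k ih =>
    refine sup_le (ih.trans (sourceAlgebra_mono N (pastSources_subset_succ k))) (sup_le ?_ ?_)
    · refine Measurable.comap_le (measurable_innovation
        ((measurable_filterError_pastSources s N k).mono
          (sourceAlgebra_mono N (pastSources_subset_succ k)) le_rfl) ?_ ?_)
      · exact measurable_family_sourceAlgebra N (i := .process k) (by simp [pastSources])
      · exact measurable_family_sourceAlgebra N (i := .sensor (k + 1)) (by simp [pastSources])
    · exact comap_family_le_sourceAlgebra N (i := .injected (k + 1)) (by simp [pastSources])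

lemma infoAlgebra_mono (s : System n m p) (N : Noise Ω n p) : Monotone (infoAlgebra s N) :=
  monotone_nat_of_le_succ fun _ => le_sup_left

lemma measurable_innovation_infoAlgebra (s : System n m p) (N : Noise Ω n p) (k : ℕ) :
    Measurable[infoAlgebra s N (k + 1)] (innovation s N k) :=
  Measurable.of_comap_le (le_sup_left.trans le_sup_right)

lemma measurable_delta_infoAlgebra (s : System n m p) (N : Noise Ω n p) (k : ℕ) :
    Measurable[infoAlgebra s N (k + 1)] (N.delta (k + 1)) :=
  Measurable.of_comap_le (le_sup_right.trans le_sup_right)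

variable {mΩ : MeasurableSpace Ω} {μ : Measure Ω}

lemma process_notMem_pastSources (k : ℕ) : Source.process k ∉ pastSources k := by
  simp [pastSources]

lemma sensor_succ_notMem_pastSources (k : ℕ) : Source.sensor (k + 1) ∉ pastSources k := by
  simp [pastSources]

lemma injected_succ_notMem_pastSources (k : ℕ) : Source.injected (k + 1) ∉ pastSources k := by
  simp [pastSources]

lemma Noise.IsGaussian.sourceAlgebra_le {s : System n m p} {SigmaDelta : Matrix (Fin p) (Fin p) ℝ}
    {N : Noise Ω n p} (hN : N.IsGaussian s SigmaDelta μ) (I : Set Source) :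
    sourceAlgebra N I ≤ mΩ :=
  iSup₂_le fun i _ => (hN.measurable i).comap_le

lemma Noise.IsGaussian.indep_sourceAlgebra {s : System n m p}
    {SigmaDelta : Matrix (Fin p) (Fin p) ℝ} {N : Noise Ω n p}
    (hN : N.IsGaussian s SigmaDelta μ) {I J : Set Source} (h : Disjoint I J) :
    Indep (sourceAlgebra N I) (sourceAlgebra N J) μ :=
  indep_iSup_of_disjoint (fun i => (hN.measurable i).comap_le) hN.indep.iIndep h

/-- The error of the Kalman filter is `N(0, P_k)` and independent of all the information
available at time `k`. -/
lemma filterError_gaussian_and_indep [IsProbabilityMeasure μ] {s : System n m p} {SigmaDelta : Matrix (Fin p) (Fin p) ℝ}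
    {N : Noise Ω n p} (hN : N.IsGaussian s SigmaDelta μ)
    (hQ : s.Q.PosSemidef) (hR : s.R.PosDef) (hSigma0 : s.Sigma0.PosSemidef) (k : ℕ) :
    IsCenteredGaussian (filterError s N k) (s.P k) μ ∧
      Indep (MeasurableSpace.comap (filterError s N k) inferInstance) (infoAlgebra s N k) μ := by
  induction k with
  | zero => exact ⟨isCenteredGaussian_sub_of_hasLaw hSigma0 hN.law_x0, indep_bot_right _⟩
  | succ k ih =>
    obtain ⟨hgauss, hind⟩ := ih
    have hw_gauss := isCenteredGaussian_of_hasLaw hQ (hN.law_w k)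
    have hv_gauss := isCenteredGaussian_of_hasLaw hR.posSemidef (hN.law_v (k + 1))
    have hle := hN.sourceAlgebra_le
    have hdisj {I J : Set Source} (h : Disjoint I J) := hN.indep_sourceAlgebra h
    have hd1 : Disjoint (pastSources k) {Source.process k} :=
      Set.disjoint_singleton_right.2 (process_notMem_pastSources k)
    have hd2 : Disjoint (pastSources k ∪ {Source.process k}) {Source.sensor (k + 1)} :=
      Set.disjoint_singleton_right.2 (by simp [sensor_succ_notMem_pastSources])
    have hd3 : Disjoint ({Source.process k} ∪ {Source.sensor (k + 1)})
        {Source.injected (k + 1)} := Set.disjoint_singleton_right.2 (by simp)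
    have hd4 : Disjoint (pastSources k)
        ({Source.process k} ∪ {Source.sensor (k + 1)} ∪ {Source.injected (k + 1)}) := by
      simp [process_notMem_pastSources, sensor_succ_notMem_pastSources,
        injected_succ_notMem_pastSources]
    set past := sourceAlgebra N (pastSources k) with hpast
    set me := MeasurableSpace.comap (filterError s N k) inferInstance with hme
    set mw := MeasurableSpace.comap (N.w k) inferInstance with hmw
    set mv := MeasurableSpace.comap (N.v (k + 1)) inferInstance with hmv
    set md := MeasurableSpace.comap (N.delta (k + 1)) inferInstance with hmd
    have hme_past : me ≤ past := (measurable_filterError_pastSources s N k).comap_le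
    have hinfo_past : infoAlgebra s N k ≤ past := infoAlgebra_le_pastSources s N k
    have hw_mem : mw ≤ sourceAlgebra N {.process k} :=
      comap_family_le_sourceAlgebra N (i := .process k) (by simp)
    have hv_mem : mv ≤ sourceAlgebra N {.sensor (k + 1)} :=
      comap_family_le_sourceAlgebra N (i := .sensor (k + 1)) (by simp)
    have hd_mem : md ≤ sourceAlgebra N {.injected (k + 1)} :=
      comap_family_le_sourceAlgebra N (i := .injected (k + 1)) (by simp)
    have hpast_le : past ≤ mΩ := hle _
    have hw_le : mw ≤ mΩ := hw_mem.trans (hle _)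
    have hv_le : mv ≤ mΩ := hv_mem.trans (hle _)
    have hd_le : md ≤ mΩ := hd_mem.trans (hle _)
    -- independence of the fresh noise
    have h_ew : Indep me mw μ := indep_of_indep_of_le (hdisj hd1) hme_past hw_mem
    have h_ew_v : Indep (me ⊔ mw) mv μ := indep_of_indep_of_le (hdisj hd2)
      (sup_le (hme_past.trans (sourceAlgebra_mono N Set.subset_union_left))
        (hw_mem.trans (sourceAlgebra_mono N Set.subset_union_right))) hv_mem
    have h_wv_d : Indep (mw ⊔ mv) md μ := indep_of_indep_of_le (hdisj hd3)
      (sup_le (hw_mem.trans (sourceAlgebra_mono N Set.subset_union_left))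
        (hv_mem.trans (sourceAlgebra_mono N Set.subset_union_right))) hd_mem
    have h_past_fresh : Indep (me ⊔ infoAlgebra s N k) ((mw ⊔ mv) ⊔ md) μ :=
      indep_of_indep_of_le (hdisj hd4) (sup_le hme_past hinfo_past)
        (sup_le (sup_le
          (hw_mem.trans (sourceAlgebra_mono N
            (Set.subset_union_left.trans Set.subset_union_left)))
          (hv_mem.trans (sourceAlgebra_mono N
            (Set.subset_union_right.trans Set.subset_union_left))))
          (hd_mem.trans (sourceAlgebra_mono N Set.subset_union_right)))
    have h_main : Indep (me ⊔ (mw ⊔ mv)) (infoAlgebra s N k ⊔ md) μ :=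
      indep_sup_sup (hme_past.trans hpast_le) (hinfo_past.trans hpast_le) (sup_le hw_le hv_le)
        hd_le hind h_wv_d h_past_fresh
    -- the prediction and update steps
    have hpred : IsCenteredGaussian (fun ω => s.A *ᵥ filterError s N k ω + N.w k ω)
        (s.predictCov (s.P k)) μ :=
      hgauss.mulVec_add hw_gauss
        ((IndepFun_iff_Indep _ _ _).2 h_ew) s.A
    have hem : Measurable[me ⊔ mw] (filterError s N k) := Measurable.of_comap_le le_sup_left
    have hwm : Measurable[me ⊔ mw] (N.w k) := Measurable.of_comap_le le_sup_right
    have hpred_v : IndepFun (fun ω => s.A *ᵥ filterError s N k ω + N.w k ω) (N.v (k + 1)) μ :=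
      (IndepFun_iff_Indep _ _ _).2
        (indep_of_indep_of_le_left h_ew_v (measurable_predictionError hem hwm).comap_le)
    obtain ⟨hupd, hupd_indep⟩ := hpred.kalman_update
      hv_gauss hpred_v hR s.C
      (K := s.gainSucc k) rfl
    refine ⟨hupd, ?_⟩
    have he3 : Measurable[me ⊔ (mw ⊔ mv)] (filterError s N k) := Measurable.of_comap_le le_sup_left
    have hw3 : Measurable[me ⊔ (mw ⊔ mv)] (N.w k) :=
      Measurable.of_comap_le (le_sup_left.trans le_sup_right)
    have hv3 : Measurable[me ⊔ (mw ⊔ mv)] (N.v (k + 1)) :=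
      Measurable.of_comap_le (le_sup_right.trans le_sup_right)
    have h_succ : MeasurableSpace.comap (filterError s N (k + 1)) inferInstance
        ≤ me ⊔ (mw ⊔ mv) := (measurable_filterError_succ he3 hw3 hv3).comap_le
    have h_innov : MeasurableSpace.comap (innovation s N k) inferInstance
        ≤ me ⊔ (mw ⊔ mv) := (measurable_innovation he3 hw3 hv3).comap_le
    have h_all : me ⊔ (mw ⊔ mv) ≤ mΩ :=
      sup_le (hme_past.trans hpast_le) (sup_le hw_le hv_le)
    have h_final := indep_sup_right (h_succ.trans h_all) (h_innov.trans h_all)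
      (sup_le (hinfo_past.trans hpast_le) hd_le)
      ((IndepFun_iff_Indep _ _ _).1 hupd_indep)
      (indep_of_indep_of_le_left h_main (sup_le h_succ h_innov))
    rwa [← sup_assoc, sup_comm (MeasurableSpace.comap _ _), sup_assoc] at h_final

end Filter

/-! ### The Kalman estimate for an arbitrary input process -/

section Estimate

variable {Ω : Type*} {n m p : ℕ} {s : System n m p} {N : Noise Ω n p} {u : ℕ → Ω → Fin m → ℝ}

/-- The Kalman estimate `x̂_{k|k}` run on the true measurements, for an input process `u`. -/
noncomputable def estOf (s : System n m p) (N : Noise Ω n p) (u : ℕ → Ω → Fin m → ℝ) :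
    ℕ → Ω → Fin n → ℝ
  | 0 => fun _ => s.x0bar
  | k + 1 => fun ω => s.filterStep k (estOf s N u k ω) (u k ω) (measOf s N u (k + 1) ω)

lemma stateOf_succ (k : ℕ) (ω : Ω) :
    stateOf s N u (k + 1) ω = s.A *ᵥ stateOf s N u k ω + s.B *ᵥ u k ω + N.w k ω := rfl

lemma stateOf_eq_estOf_add_filterError (k : ℕ) (ω : Ω) :
    stateOf s N u k ω = estOf s N u k ω + filterError s N k ω := by
  induction k with
  | zero => simp [stateOf, System.state, estOf, filterError]
  | succ k ih =>
    simp only [estOf, filterError, System.filterStep, measOf, stateOf_succ]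
    rw [ih]
    simp only [mulVec_add, mulVec_sub]
    abel

lemma measOf_succ_eq_innovation (k : ℕ) (ω : Ω) :
    measOf s N u (k + 1) ω = innovation s N k ω
      + s.C *ᵥ (s.A *ᵥ estOf s N u k ω + s.B *ᵥ u k ω) := by
  simp only [measOf, stateOf_succ, innovation, stateOf_eq_estOf_add_filterError, mulVec_add]
  abel

lemma measurable_filterStep {𝓖 : MeasurableSpace Ω} {e : Ω → Fin n → ℝ} {v : Ω → Fin m → ℝ}
    {y : Ω → Fin p → ℝ} (he : Measurable[𝓖] e) (hv : Measurable[𝓖] v) (hy : Measurable[𝓖] y)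
    (k : ℕ) : Measurable[𝓖] fun ω => s.filterStep k (e ω) (v ω) (y ω) := by
  have h1 : Measurable[𝓖] fun ω => s.A *ᵥ e ω + s.B *ᵥ v ω :=
    (measurable_mulVec s.A he).add (measurable_mulVec s.B hv)
  exact h1.add (measurable_mulVec _ (hy.sub (measurable_mulVec s.C h1)))

lemma memLp_filterStep {mΩ : MeasurableSpace Ω} {μ : Measure Ω} {e : Ω → Fin n → ℝ}
    {v : Ω → Fin m → ℝ} {y : Ω → Fin p → ℝ} (he : MemLp e 2 μ) (hv : MemLp v 2 μ)
    (hy : MemLp y 2 μ) (k : ℕ) :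
    MemLp (fun ω => s.filterStep k (e ω) (v ω) (y ω)) 2 μ := by
  have h1 : MemLp (fun ω => s.A *ᵥ e ω + s.B *ᵥ v ω) 2 μ :=
    (memLp_mulVec s.A he).add (memLp_mulVec s.B hv)
  exact h1.add (memLp_mulVec _ (hy.sub (memLp_mulVec s.C h1)))

lemma measurable_measOf_succ_infoAlgebra {k : ℕ}
    (he : Measurable[infoAlgebra s N k] (estOf s N u k))
    (hu : Measurable[infoAlgebra s N k] (u k)) :
    Measurable[infoAlgebra s N (k + 1)] (measOf s N u (k + 1)) := by
  have hle := infoAlgebra_mono s N k.le_succ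
  rw [show measOf s N u (k + 1) = fun ω => innovation s N k ω
      + s.C *ᵥ (s.A *ᵥ estOf s N u k ω + s.B *ᵥ u k ω) from
    funext fun ω => measOf_succ_eq_innovation k ω]
  exact (measurable_innovation_infoAlgebra s N k).add (measurable_mulVec s.C
    ((measurable_mulVec s.A (he.mono hle le_rfl)).add (measurable_mulVec s.B (hu.mono hle le_rfl))))

lemma measurable_estOf_succ_infoAlgebra {k : ℕ}
    (he : Measurable[infoAlgebra s N k] (estOf s N u k))
    (hu : Measurable[infoAlgebra s N k] (u k)) :
    Measurable[infoAlgebra s N (k + 1)] (estOf s N u (k + 1)) :=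
  have hle := infoAlgebra_mono s N k.le_succ
  measurable_filterStep (he.mono hle le_rfl) (hu.mono hle le_rfl)
    (measurable_measOf_succ_infoAlgebra he hu) k

lemma measurable_estOf_infoAlgebra (hu : ∀ k < s.T, Measurable[infoAlgebra s N k] (u k))
    {k : ℕ} (hk : k ≤ s.T) : Measurable[infoAlgebra s N k] (estOf s N u k) := by
  induction k with
  | zero => exact @measurable_const _ _ _ (infoAlgebra s N 0) _
  | succ k ih =>
    exact measurable_estOf_succ_infoAlgebra (ih (by omega)) (hu k (by omega))

end Estimate

/-! ### The cost of a nonanticipative input process -/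

section Cost

variable {Ω : Type*} {n m p : ℕ} {s : System n m p} {N : Noise Ω n p} {u : ℕ → Ω → Fin m → ℝ}

/-- Square-integrable inputs which, up to the horizon, depend only on the information carried by
the innovations and the injected noise. -/
structure IsNonanticipative {mΩ : MeasurableSpace Ω} (s : System n m p) (N : Noise Ω n p)
    (μ : Measure Ω) (u : ℕ → Ω → Fin m → ℝ) : Prop where
  measurable : ∀ k < s.T, Measurable[infoAlgebra s N k] (u k)
  memLp : ∀ k < s.T, MemLp (u k) 2 μ

/-- `E(x₀' S₀ x₀) + ∑ tr(S_{k+1} Q) + ∑ tr(Φ_k P_k)`, the part of the cost that no input can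
influence. -/
noncomputable def baseCost {mΩ : MeasurableSpace Ω} (s : System n m p) (N : Noise Ω n p)
    (μ : Measure Ω) : ℝ :=
  (∫ ω, N.x0 ω ⬝ᵥ s.S 0 *ᵥ N.x0 ω ∂μ)
    + ∑ k ∈ Finset.range s.T, (s.S (k + 1) * s.Q).trace
    + ∑ k ∈ Finset.range s.T, (s.Phi k * s.P k).trace

/-- The deviation `u_k - L_k x̂_{k|k}` of the input from certainty-equivalent control. -/
noncomputable def controlGap (s : System n m p) (N : Noise Ω n p) (u : ℕ → Ω → Fin m → ℝ) (k : ℕ)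
    (ω : Ω) : Fin m → ℝ :=
  u k ω - s.L k *ᵥ estOf s N u k ω

/-- The contribution of time `k` to the cost after completion of the square. The second and the
fourth term have mean zero. -/
noncomputable def stageCost (s : System n m p) (N : Noise Ω n p) (u : ℕ → Ω → Fin m → ℝ) (k : ℕ)
    (ω : Ω) : ℝ :=
  N.w k ω ⬝ᵥ s.S (k + 1) *ᵥ N.w k ω
    + 2 * (N.w k ω ⬝ᵥ s.S (k + 1) *ᵥ (s.A *ᵥ stateOf s N u k ω + s.B *ᵥ u k ω))
    + filterError s N k ω ⬝ᵥ s.Phi k *ᵥ filterError s N k ω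
    - 2 * ((s.L k *ᵥ filterError s N k ω) ⬝ᵥ s.inputWeight k *ᵥ controlGap s N u k ω)
    + controlGap s N u k ω ⬝ᵥ s.inputWeight k *ᵥ controlGap s N u k ω

lemma cost_step (hW : s.W.PosSemidef) (hU : s.U.PosDef) {k : ℕ} (hk : k < s.T) (ω : Ω) :
    stateOf s N u k ω ⬝ᵥ s.W *ᵥ stateOf s N u k ω + u k ω ⬝ᵥ s.U *ᵥ u k ω
        + stateOf s N u (k + 1) ω ⬝ᵥ s.S (k + 1) *ᵥ stateOf s N u (k + 1) ω
      = stateOf s N u k ω ⬝ᵥ s.S k *ᵥ stateOf s N u k ω + stageCost s N u k ω := by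
  have hS : (s.S (k + 1)).PosSemidef := System.posSemidef_S hW hU hk
  have hsymm := transpose_eq_of_posSemidef hS
  have hM := transpose_eq_of_posSemidef (System.posDef_inputWeight hW hU hk).posSemidef
  have h1 := System.riccati_complete_square hU hk hS (stateOf s N u k ω) (u k ω)
  have h2 : u k ω - s.L k *ᵥ stateOf s N u k ω
      = controlGap s N u k ω - s.L k *ᵥ filterError s N k ω := by
    rw [stateOf_eq_estOf_add_filterError, controlGap, mulVec_add]
    abel
  have h3 := System.dotProduct_inputWeight_L hU hS (filterError s N k ω)
  rw [h2] at h1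
  rw [stateOf_succ, stageCost]
  generalize s.A *ᵥ stateOf s N u k ω + s.B *ᵥ u k ω = a at *
  generalize controlGap s N u k ω = r at *
  generalize s.L k *ᵥ filterError s N k ω = l at *
  have h4 : (a + N.w k ω) ⬝ᵥ s.S (k + 1) *ᵥ (a + N.w k ω)
      = a ⬝ᵥ s.S (k + 1) *ᵥ a + 2 * (N.w k ω ⬝ᵥ s.S (k + 1) *ᵥ a)
        + N.w k ω ⬝ᵥ s.S (k + 1) *ᵥ N.w k ω := by
    simp only [mulVec_add, add_dotProduct, dotProduct_add]
    rw [dotProduct_mulVec_comm_of_isSymm hsymm a (N.w k ω)]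
    ring
  have h5 : (r - l) ⬝ᵥ s.inputWeight k *ᵥ (r - l)
      = r ⬝ᵥ s.inputWeight k *ᵥ r - 2 * (l ⬝ᵥ s.inputWeight k *ᵥ r)
        + l ⬝ᵥ s.inputWeight k *ᵥ l := by
    simp only [mulVec_sub, sub_dotProduct, dotProduct_sub]
    rw [dotProduct_mulVec_comm_of_isSymm hM r l]
    ring
  rw [h4]
  rw [h5, h3] at h1
  linarith

lemma pathCostOf_eq_sum_stageCost (hW : s.W.PosSemidef) (hU : s.U.PosDef) (ω : Ω) :
    pathCostOf s N u ω
      = N.x0 ω ⬝ᵥ s.S 0 *ᵥ N.x0 ω + ∑ k ∈ Finset.range s.T, stageCost s N u k ω := by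
  have h (j : ℕ) (hj : j ≤ s.T) :
      ∑ k ∈ Finset.range j, (stateOf s N u k ω ⬝ᵥ s.W *ᵥ stateOf s N u k ω
          + u k ω ⬝ᵥ s.U *ᵥ u k ω) + stateOf s N u j ω ⬝ᵥ s.S j *ᵥ stateOf s N u j ω
        = N.x0 ω ⬝ᵥ s.S 0 *ᵥ N.x0 ω + ∑ k ∈ Finset.range j, stageCost s N u k ω := by
    induction j with
    | zero => simp [stateOf, System.state]
    | succ j ih =>
      have h1 := cost_step (N := N) (u := u) hW hU hj ω
      have h2 := ih (by omega)
      rw [Finset.sum_range_succ, Finset.sum_range_succ]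
      linarith
  have hT := h s.T le_rfl
  rw [System.S_horizon] at hT
  exact hT

variable {mΩ : MeasurableSpace Ω} {μ : Measure Ω} [IsProbabilityMeasure μ]
  {SigmaDelta : Matrix (Fin p) (Fin p) ℝ}

lemma memLp_x0 (hN : N.IsGaussian s SigmaDelta μ) (hSigma0 : s.Sigma0.PosSemidef) :
    MemLp N.x0 2 μ := by
  have h := (isCenteredGaussian_sub_of_hasLaw hSigma0 hN.law_x0).memLp.add
    (memLp_const (μ := μ) (p := 2) s.x0bar)
  convert h using 1
  funext ω
  simp

lemma memLp_stateOf (hN : N.IsGaussian s SigmaDelta μ) (hQ : s.Q.PosSemidef)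
    (hSigma0 : s.Sigma0.PosSemidef) {k : ℕ} (hu : ∀ j < k, MemLp (u j) 2 μ) :
    MemLp (stateOf s N u k) 2 μ := by
  induction k with
  | zero => exact memLp_x0 hN hSigma0
  | succ k ih =>
    exact ((memLp_mulVec s.A (ih fun j hj => hu j (by omega))).add
      (memLp_mulVec s.B (hu k (by omega)))).add (isCenteredGaussian_of_hasLaw hQ (hN.law_w k)).memLp

lemma memLp_estOf (hN : N.IsGaussian s SigmaDelta μ) (hQ : s.Q.PosSemidef) (hR : s.R.PosDef)
    (hSigma0 : s.Sigma0.PosSemidef) {k : ℕ} (hu : ∀ j < k, MemLp (u j) 2 μ) :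
    MemLp (estOf s N u k) 2 μ := by
  have h := (memLp_stateOf hN hQ hSigma0 hu).sub
    (filterError_gaussian_and_indep hN hQ hR hSigma0 k).1.memLp
  have heq : estOf s N u k = stateOf s N u k - filterError s N k := by
    funext ω
    simp [stateOf_eq_estOf_add_filterError]
  rwa [heq]

lemma memLp_controlGap (hN : N.IsGaussian s SigmaDelta μ) (hQ : s.Q.PosSemidef) (hR : s.R.PosDef)
    (hSigma0 : s.Sigma0.PosSemidef) (hu : IsNonanticipative s N μ u) {k : ℕ} (hk : k < s.T) :
    MemLp (controlGap s N u k) 2 μ :=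
  (hu.memLp k hk).sub (memLp_mulVec _
    (memLp_estOf hN hQ hR hSigma0 fun j hj => hu.memLp j (hj.trans hk)))

lemma stageCost_integral (hN : N.IsGaussian s SigmaDelta μ) (hQ : s.Q.PosSemidef)
    (hR : s.R.PosDef) (hSigma0 : s.Sigma0.PosSemidef) (hu : IsNonanticipative s N μ u)
    {k : ℕ} (hk : k < s.T) :
    Integrable (stageCost s N u k) μ ∧
      ∫ ω, stageCost s N u k ω ∂μ = (s.S (k + 1) * s.Q).trace + (s.Phi k * s.P k).trace
        + ∫ ω, controlGap s N u k ω ⬝ᵥ s.inputWeight k *ᵥ controlGap s N u k ω ∂μ := by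
  obtain ⟨he, he_indep⟩ := filterError_gaussian_and_indep hN hQ hR hSigma0 k
  have hw := isCenteredGaussian_of_hasLaw hQ (hN.law_w k)
  have hx : MemLp (stateOf s N u k) 2 μ :=
    memLp_stateOf hN hQ hSigma0 fun j hj => hu.memLp j (hj.trans hk)
  have ha : MemLp (fun ω => s.A *ᵥ stateOf s N u k ω + s.B *ᵥ u k ω) 2 μ :=
    (memLp_mulVec s.A hx).add (memLp_mulVec s.B (hu.memLp k hk))
  have hr := memLp_controlGap hN hQ hR hSigma0 hu hk
  have hest := measurable_estOf_infoAlgebra hu.measurable hk.le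
  -- the state and the input at time `k` are functions of the past, hence independent of `w_k`
  have hpast := infoAlgebra_le_pastSources s N k
  have hx_past : Measurable[sourceAlgebra N (pastSources k)] (stateOf s N u k) := by
    rw [show stateOf s N u k = fun ω => estOf s N u k ω + filterError s N k ω from
      funext fun ω => stateOf_eq_estOf_add_filterError k ω]
    exact (hest.mono hpast le_rfl).add (measurable_filterError_pastSources s N k)
  have ha_past : Measurable[sourceAlgebra N (pastSources k)]
      fun ω => s.A *ᵥ stateOf s N u k ω + s.B *ᵥ u k ω :=
    (measurable_mulVec s.A hx_past).add
      (measurable_mulVec s.B ((hu.measurable k hk).mono hpast le_rfl))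
  have hdisj : Disjoint {Source.process k} (pastSources k) :=
    Set.disjoint_singleton_left.2 (process_notMem_pastSources k)
  have hwa : IndepFun (N.w k) (fun ω => s.A *ᵥ stateOf s N u k ω + s.B *ᵥ u k ω) μ :=
    (IndepFun_iff_Indep _ _ _).2 (indep_of_indep_of_le (hN.indep_sourceAlgebra hdisj)
      (comap_family_le_sourceAlgebra N (i := .process k) (by simp)) ha_past.comap_le)
  have hwa0 := crossMoment_eq_zero_of_indepFun hwa hw.memLp ha hw.mean
  -- the control gap is a function of the information, hence independent of the error
  have hr_info : Measurable[infoAlgebra s N k] (controlGap s N u k) :=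
    (hu.measurable k hk).sub (measurable_mulVec _ hest)
  have her : IndepFun (filterError s N k) (controlGap s N u k) μ :=
    (IndepFun_iff_Indep _ _ _).2 (indep_of_indep_of_le_right he_indep hr_info.comap_le)
  have her0 := crossMoment_eq_zero_of_indepFun her he.memLp hr he.mean
  have hLe := memLp_mulVec (s.L k) he.memLp
  have i1 := integrable_dotProduct_mulVec (s.S (k + 1)) hw.memLp hw.memLp
  have i2 := (integrable_dotProduct_mulVec (s.S (k + 1)) hw.memLp ha).const_mul 2
  have i3 := integrable_dotProduct_mulVec (s.Phi k) he.memLp he.memLp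
  have i4 := (integrable_dotProduct_mulVec (s.inputWeight k) hLe hr).const_mul 2
  have i5 := integrable_dotProduct_mulVec (s.inputWeight k) hr hr
  refine ⟨(((i1.add i2).add i3).sub i4).add i5, ?_⟩
  have e2 : ∫ ω, 2 * (N.w k ω ⬝ᵥ s.S (k + 1) *ᵥ (s.A *ᵥ stateOf s N u k ω + s.B *ᵥ u k ω)) ∂μ
      = 0 := by
    rw [integral_const_mul, integral_dotProduct_mulVec _ hw.memLp ha, ← crossMoment_transpose,
      hwa0]
    simp
  have e4 : ∫ ω, 2 * ((s.L k *ᵥ filterError s N k ω) ⬝ᵥ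
      s.inputWeight k *ᵥ controlGap s N u k ω) ∂μ = 0 := by
    rw [integral_const_mul, integral_dotProduct_mulVec _ hLe hr, ← crossMoment_transpose,
      crossMoment_mulVec_left _ he.memLp hr, her0]
    simp
  have hsum := integral_add' (((i1.add i2).add i3).sub i4) i5
  rw [integral_sub' ((i1.add i2).add i3) i4, integral_add' (i1.add i2) i3, integral_add' i1 i2,
    e2, e4, integral_dotProduct_mulVec _ hw.memLp hw.memLp, hw.moment,
    integral_dotProduct_mulVec _ he.memLp he.memLp, he.moment] at hsum
  refine Eq.trans hsum ?_
  ring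

/-- The cost of a nonanticipative input process exceeds `baseCost` by the mean weighted square of
its deviation from certainty-equivalent control. -/
lemma pathCostOf_integral (hN : N.IsGaussian s SigmaDelta μ) (hQ : s.Q.PosSemidef)
    (hR : s.R.PosDef) (hW : s.W.PosSemidef) (hU : s.U.PosDef) (hSigma0 : s.Sigma0.PosSemidef)
    (hu : IsNonanticipative s N μ u) :
    Integrable (pathCostOf s N u) μ ∧
      ∫ ω, pathCostOf s N u ω ∂μ = baseCost s N μ + ∑ k ∈ Finset.range s.T,
        ∫ ω, controlGap s N u k ω ⬝ᵥ s.inputWeight k *ᵥ controlGap s N u k ω ∂μ := by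
  have hst (k : ℕ) (hk : k ∈ Finset.range s.T) :=
    stageCost_integral hN hQ hR hSigma0 hu (Finset.mem_range.1 hk)
  have hx0 := memLp_x0 hN hSigma0
  have i0 := integrable_dotProduct_mulVec (s.S 0) hx0 hx0
  have isum := integrable_finsetSum (Finset.range s.T) fun k hk => (hst k hk).1
  rw [show pathCostOf s N u = fun ω => N.x0 ω ⬝ᵥ s.S 0 *ᵥ N.x0 ω
      + ∑ k ∈ Finset.range s.T, stageCost s N u k ω from
    funext fun ω => pathCostOf_eq_sum_stageCost hW hU ω]
  refine ⟨i0.add isum, ?_⟩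
  rw [integral_add i0 isum, integral_finsetSum _ fun k hk => (hst k hk).1,
    Finset.sum_congr rfl fun k hk => (hst k hk).2, Finset.sum_add_distrib,
    Finset.sum_add_distrib, baseCost]
  ring

end Cost

/-! ### Output-feedback control -/

section Admissible

variable {Ω : Type*} {n m p : ℕ} {s : System n m p} {N : Noise Ω n p} {u : ℕ → Ω → Fin m → ℝ}

lemma sigmaMeas_mono (y : ℕ → Ω → Fin p → ℝ) : Monotone (sigmaMeas y) :=
  fun _ _ h => biSup_mono fun _ hi => Finset.Icc_subset_Icc_right h hi

lemma measurable_sigmaMeas (y : ℕ → Ω → Fin p → ℝ) {i k : ℕ} (hi : 1 ≤ i) (hik : i ≤ k) :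
    Measurable[sigmaMeas y k] (y i) :=
  Measurable.of_comap_le (le_biSup (fun i => MeasurableSpace.comap (y i) inferInstance)
    (Finset.mem_Icc.2 ⟨hi, hik⟩))

lemma sigmaMeas_le_of_forall {y : ℕ → Ω → Fin p → ℝ} {k : ℕ} {𝓖 : MeasurableSpace Ω}
    (h : ∀ i < k, Measurable[𝓖] (y (i + 1))) : sigmaMeas y k ≤ 𝓖 := by
  refine iSup₂_le fun i hi => ?_
  obtain ⟨h1, h2⟩ := Finset.mem_Icc.1 hi
  obtain ⟨j, rfl⟩ : ∃ j, i = j + 1 := ⟨i - 1, by omega⟩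
  exact (h j (by omega)).comap_le

lemma IsAdmissible.sigmaMeas_le_infoAlgebra (hu : IsAdmissible s N u) {k : ℕ} (hk : k ≤ s.T) :
    sigmaMeas (measOf s N u) k ≤ infoAlgebra s N k ∧
      Measurable[infoAlgebra s N k] (estOf s N u k) := by
  induction k with
  | zero =>
    exact ⟨by simp [sigmaMeas], @measurable_const _ _ _ (infoAlgebra s N 0) _⟩
  | succ k ih =>
    obtain ⟨hle, hest⟩ := ih (by omega)
    have huk : Measurable[infoAlgebra s N k] (u k) := (hu k hk).mono hle le_rfl
    refine ⟨sigmaMeas_le_of_forall fun i hi => ?_, measurable_estOf_succ_infoAlgebra hest huk⟩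
    obtain rfl | hik := (Nat.lt_succ_iff.1 hi).eq_or_lt
    · exact measurable_measOf_succ_infoAlgebra hest huk
    · exact (measurable_sigmaMeas _ (by omega) hik).mono
        (hle.trans (infoAlgebra_mono s N k.le_succ)) le_rfl

variable {mΩ : MeasurableSpace Ω} {μ : Measure Ω} {SigmaDelta : Matrix (Fin p) (Fin p) ℝ}

/-- An output-feedback control of finite cost is square-integrable, because `U > 0`. -/
lemma IsAdmissible.isNonanticipative (hN : N.IsGaussian s SigmaDelta μ)
    (hW : s.W.PosSemidef) (hU : s.U.PosDef) (hu : IsAdmissible s N u)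
    (hint : Integrable (pathCostOf s N u) μ) : IsNonanticipative s N μ u := by
  have hmeas (k : ℕ) (hk : k < s.T) : Measurable[infoAlgebra s N k] (u k) :=
    (hu k hk).mono (hu.sigmaMeas_le_infoAlgebra hk.le).1 le_rfl
  refine ⟨hmeas, fun k hk => ?_⟩
  have hle : infoAlgebra s N k ≤ mΩ := (infoAlgebra_le_pastSources s N k).trans
    (hN.sourceAlgebra_le _)
  have huk : Measurable (u k) := (hmeas k hk).mono hle le_rfl
  refine MemLp.of_eval fun i => ?_
  have hui : Measurable fun ω => u k ω i := (measurable_pi_apply i).comp huk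
  rw [memLp_two_iff_integrable_sq hui.aestronglyMeasurable]
  refine (hint.const_mul (s.U⁻¹ i i)).mono' (hui.pow_const 2).aestronglyMeasurable
    (.of_forall fun ω => ?_)
  rw [Real.norm_of_nonneg (sq_nonneg _)]
  refine (sq_apply_le_of_posDef hU (u k ω) i).trans
    (mul_le_mul_of_nonneg_left ?_ hU.inv.posSemidef.diag_nonneg)
  have hterm (j : ℕ) : 0 ≤ stateOf s N u j ω ⬝ᵥ s.W *ᵥ stateOf s N u j ω
      + u j ω ⬝ᵥ s.U *ᵥ u j ω :=
    add_nonneg (dotProduct_mulVec_self_nonneg hW _)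
      (dotProduct_mulVec_self_nonneg hU.posSemidef _)
  have h1 := Finset.single_le_sum (fun j _ => hterm j) (Finset.mem_range.2 hk)
  have h2 := dotProduct_mulVec_self_nonneg hW (stateOf s N u k ω)
  have h3 := dotProduct_mulVec_self_nonneg hW (stateOf s N u s.T ω)
  rw [pathCostOf, System.pathCost]
  linarith

lemma baseCost_le_of_isNonanticipative [IsProbabilityMeasure μ] (hN : N.IsGaussian s SigmaDelta μ)
    (hQ : s.Q.PosSemidef) (hR : s.R.PosDef) (hW : s.W.PosSemidef) (hU : s.U.PosDef)
    (hSigma0 : s.Sigma0.PosSemidef) (hu : IsNonanticipative s N μ u) :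
    baseCost s N μ ≤ ∫ ω, pathCostOf s N u ω ∂μ := by
  rw [(pathCostOf_integral hN hQ hR hW hU hSigma0 hu).2]
  exact le_add_of_nonneg_right (Finset.sum_nonneg fun k hk => integral_nonneg fun ω =>
    dotProduct_mulVec_self_nonneg
      (System.posDef_inputWeight hW hU (Finset.mem_range.1 hk)).posSemidef _)

end Admissible

/-! ### The closed loop -/

section Loop

variable {Ω : Type*} {n m p : ℕ} (s : System n m p) (N : Noise Ω n p)

lemma loop_eq_stateOf_estOf (k : ℕ) (ω : Ω) :
    loopState s N k ω = stateOf s N (loopInput s N) k ω ∧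
      loopEst s N k ω = estOf s N (loopInput s N) k ω := by
  induction k with
  | zero => exact ⟨rfl, rfl⟩
  | succ k ih =>
    obtain ⟨h1, h2⟩ := ih
    have hx : loopState s N (k + 1) ω = stateOf s N (loopInput s N) (k + 1) ω := by
      rw [stateOf_succ, ← h1]
      rfl
    refine ⟨hx, ?_⟩
    simp only [estOf]
    rw [← h2, measOf, ← hx]
    rfl

lemma loopState_eq_stateOf (k : ℕ) : loopState s N k = stateOf s N (loopInput s N) k :=
  funext fun ω => (loop_eq_stateOf_estOf s N k ω).1

lemma loopEst_eq_estOf (k : ℕ) : loopEst s N k = estOf s N (loopInput s N) k :=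
  funext fun ω => (loop_eq_stateOf_estOf s N k ω).2

lemma loopMeas_eq_measOf : loopMeas s N = measOf s N (loopInput s N) := by
  funext k ω
  rw [loopMeas, loopState_eq_stateOf, measOf]

lemma loopPathCost_eq_pathCostOf : loopPathCost s N = pathCostOf s N (loopInput s N) := by
  funext ω
  simp only [loopPathCost, pathCostOf, loopState_eq_stateOf]

lemma loop_pub_succ (k : ℕ) (ω : Ω) : (loop s N ω (k + 1)).pub =
    s.filterStep k (loop s N ω k).pub (loopInput s N k ω)
      (loopMeas s N (k + 1) ω + N.delta (k + 1) ω) := rfl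

lemma loopEst_succ (k : ℕ) (ω : Ω) : loopEst s N (k + 1) ω =
    s.filterStep k (loopEst s N k ω) (loopInput s N k ω) (loopMeas s N (k + 1) ω) := rfl

lemma controlGap_loopInput (k : ℕ) (ω : Ω) :
    controlGap s N (loopInput s N) k ω = s.L k *ᵥ deviation s N k ω := by
  rw [controlGap, ← loopEst_eq_estOf, loopInput, deviation, mulVec_sub, loopEst]

variable {s N}

lemma measurable_loop_infoAlgebra (k : ℕ) :
    Measurable[infoAlgebra s N k] (fun ω => (loop s N ω k).pub) ∧
      Measurable[infoAlgebra s N k] (estOf s N (loopInput s N) k) := by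
  induction k with
  | zero => exact ⟨@measurable_const _ _ _ (infoAlgebra s N 0) _,
      @measurable_const _ _ _ (infoAlgebra s N 0) _⟩
  | succ k ih =>
    obtain ⟨hpub, hest⟩ := ih
    have hu : Measurable[infoAlgebra s N k] (loopInput s N k) := measurable_mulVec _ hpub
    have hle := infoAlgebra_mono s N k.le_succ
    refine ⟨?_, measurable_estOf_succ_infoAlgebra hest hu⟩
    simp only [loop_pub_succ, loopMeas_eq_measOf]
    exact measurable_filterStep (hpub.mono hle le_rfl) (hu.mono hle le_rfl)
      ((measurable_measOf_succ_infoAlgebra hest hu).add (measurable_delta_infoAlgebra s N k)) k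

lemma measurable_loopInput_infoAlgebra (k : ℕ) :
    Measurable[infoAlgebra s N k] (loopInput s N k) :=
  measurable_mulVec _ (measurable_loop_infoAlgebra k).1

lemma measurable_loopMeas_infoAlgebra (k : ℕ) :
    Measurable[infoAlgebra s N (k + 1)] (loopMeas s N (k + 1)) := by
  rw [loopMeas_eq_measOf]
  exact measurable_measOf_succ_infoAlgebra (measurable_loop_infoAlgebra k).2
    (measurable_loopInput_infoAlgebra k)

lemma sigmaMeas_loopMeas_le_infoAlgebra (k : ℕ) :
    sigmaMeas (loopMeas s N) k ≤ infoAlgebra s N k :=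
  sigmaMeas_le_of_forall fun i hi =>
    (measurable_loopMeas_infoAlgebra i).mono (infoAlgebra_mono s N hi) le_rfl

lemma sigmaInfo_le_infoAlgebra (k : ℕ) : sigmaInfo s N k ≤ infoAlgebra s N k := by
  refine sup_le (sigmaMeas_loopMeas_le_infoAlgebra k) (iSup₂_le fun i hi => ?_)
  exact ((measurable_loopInput_infoAlgebra i).mono
    (infoAlgebra_mono s N (Finset.mem_range.1 hi).le) le_rfl).comap_le

lemma measurable_loopEst_sigmaInfo (k : ℕ) : Measurable[sigmaInfo s N k] (loopEst s N k) := by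
  induction k with
  | zero => exact @measurable_const _ _ _ (sigmaInfo s N 0) _
  | succ k ih =>
    have hle : sigmaInfo s N k ≤ sigmaInfo s N (k + 1) :=
      sup_le_sup (sigmaMeas_mono _ k.le_succ)
        (biSup_mono fun i hi => Finset.mem_range.2 (by have := Finset.mem_range.1 hi; omega))
    have hu : Measurable[sigmaInfo s N (k + 1)] (loopInput s N k) :=
      Measurable.of_comap_le (le_trans
        (le_biSup (fun i => MeasurableSpace.comap (loopInput s N i) inferInstance)
          (Finset.mem_range.2 k.lt_succ_self)) le_sup_right)
    have hy : Measurable[sigmaInfo s N (k + 1)] (loopMeas s N (k + 1)) :=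
      (measurable_sigmaMeas _ (by omega) le_rfl).mono le_sup_left le_rfl
    exact measurable_filterStep (ih.mono hle le_rfl) hu hy k

lemma pub_ordinary_eq_est (k : ℕ) (ω : Ω) :
    (loop s N.ordinary ω k).pub = loopEst s N.ordinary k ω := by
  induction k with
  | zero => rfl
  | succ k ih =>
    rw [loop_pub_succ, loopEst_succ, ih]
    simp [Noise.ordinary]

lemma measurable_ordinary_pub (k : ℕ) :
    Measurable[sigmaMeas (loopMeas s N.ordinary) k] (fun ω => (loop s N.ordinary ω k).pub) := by
  induction k with
  | zero => exact @measurable_const _ _ _ (sigmaMeas (loopMeas s N.ordinary) 0) _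
  | succ k ih =>
    have h := ih.mono (sigmaMeas_mono (loopMeas s N.ordinary) k.le_succ) le_rfl
    have hu : Measurable[sigmaMeas (loopMeas s N.ordinary) (k + 1)] (loopInput s N.ordinary k) :=
      measurable_mulVec _ h
    simp only [pub_ordinary_eq_est] at h ⊢
    exact measurable_filterStep h hu (measurable_sigmaMeas _ (by omega) le_rfl) k

lemma measOf_ordinary (u : ℕ → Ω → Fin m → ℝ) : measOf s N.ordinary u = measOf s N u := rfl

lemma pathCostOf_ordinary (u : ℕ → Ω → Fin m → ℝ) :
    pathCostOf s N.ordinary u = pathCostOf s N u := rfl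

lemma estOf_ordinary (u : ℕ → Ω → Fin m → ℝ) (k : ℕ) : estOf s N.ordinary u k = estOf s N u k := by
  induction k with
  | zero => rfl
  | succ k ih => simp only [estOf, ih, measOf_ordinary]

lemma isAdmissible_ordinary : IsAdmissible s N (loopInput s N.ordinary) := by
  intro k _
  rw [← measOf_ordinary, ← loopMeas_eq_measOf]
  exact measurable_mulVec _ (measurable_ordinary_pub k)

lemma controlGap_ordinary (k : ℕ) (ω : Ω) : controlGap s N (loopInput s N.ordinary) k ω = 0 := by
  rw [controlGap, ← estOf_ordinary, ← loopEst_eq_estOf, loopInput, pub_ordinary_eq_est, sub_self]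

variable {mΩ : MeasurableSpace Ω} {μ : Measure Ω} {SigmaDelta : Matrix (Fin p) (Fin p) ℝ}

lemma Noise.IsGaussian.infoAlgebra_le (hN : N.IsGaussian s SigmaDelta μ) (k : ℕ) :
    infoAlgebra s N k ≤ mΩ :=
  (infoAlgebra_le_pastSources s N k).trans (hN.sourceAlgebra_le _)

lemma Noise.IsGaussian.measurable_filterError (hN : N.IsGaussian s SigmaDelta μ) (k : ℕ) :
    Measurable (filterError s N k) :=
  (measurable_filterError_pastSources s N k).mono (hN.sourceAlgebra_le _) le_rfl

variable [IsProbabilityMeasure μ]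

/-- Square-integrability of the closed loop. The injected noise enters only through the square
integrability of the vectors `δ_k`, so that one statement serves `N` and `N.ordinary`. -/
lemma memLp_loop {N' : Noise Ω n p} (hx0 : MemLp N'.x0 2 μ) (hw : ∀ k, MemLp (N'.w k) 2 μ)
    (hv : ∀ k, MemLp (N'.v k) 2 μ) (hd : ∀ k, MemLp (N'.delta k) 2 μ) (k : ℕ) :
    MemLp (loopState s N' k) 2 μ ∧ MemLp (fun ω => (loop s N' ω k).pub) 2 μ ∧
      MemLp (loopEst s N' k) 2 μ := by
  induction k with
  | zero => exact ⟨hx0, memLp_const _, memLp_const _⟩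
  | succ k ih =>
    obtain ⟨hx, hpub, hest⟩ := ih
    have hu : MemLp (loopInput s N' k) 2 μ := memLp_mulVec _ hpub
    have hx' : MemLp (loopState s N' (k + 1)) 2 μ :=
      ((memLp_mulVec s.A hx).add (memLp_mulVec s.B hu)).add (hw k)
    have hy : MemLp (loopMeas s N' (k + 1)) 2 μ := (memLp_mulVec s.C hx').add (hv (k + 1))
    exact ⟨hx', memLp_filterStep hpub hu (hy.add (hd (k + 1))) k,
      memLp_filterStep hest hu hy k⟩

end Loop

/-! ### Conditional mean, optimal value and cost of the privacy scheme -/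

section Results

variable {Ω : Type*} {n m p : ℕ} {s : System n m p} {N : Noise Ω n p}
  {mΩ : MeasurableSpace Ω} {μ : Measure Ω} [IsProbabilityMeasure μ]
  {SigmaDelta : Matrix (Fin p) (Fin p) ℝ}

lemma Noise.IsGaussian.memLp_loop (hN : N.IsGaussian s SigmaDelta μ) (hQ : s.Q.PosSemidef)
    (hR : s.R.PosDef) (hSigma0 : s.Sigma0.PosSemidef) (hSigmaDelta : SigmaDelta.PosSemidef)
    (k : ℕ) :
    MemLp (loopState s N k) 2 μ ∧ MemLp (fun ω => (loop s N ω k).pub) 2 μ ∧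
      MemLp (loopEst s N k) 2 μ :=
  PrivateLQG.memLp_loop (memLp_x0 hN hSigma0)
    (fun k => (isCenteredGaussian_of_hasLaw hQ (hN.law_w k)).memLp)
    (fun k => (isCenteredGaussian_of_hasLaw hR.posSemidef (hN.law_v k)).memLp)
    (fun k => (isCenteredGaussian_of_hasLaw hSigmaDelta (hN.law_delta k)).memLp) k

lemma isNonanticipative_loopInput (hN : N.IsGaussian s SigmaDelta μ) (hQ : s.Q.PosSemidef)
    (hR : s.R.PosDef) (hSigma0 : s.Sigma0.PosSemidef) (hSigmaDelta : SigmaDelta.PosSemidef) :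
    IsNonanticipative s N μ (loopInput s N) :=
  ⟨fun k _ => measurable_loopInput_infoAlgebra k, fun k _ =>
    memLp_mulVec _ (hN.memLp_loop hQ hR hSigma0 hSigmaDelta k).2.1⟩

lemma isNonanticipative_ordinary (hN : N.IsGaussian s SigmaDelta μ) (hQ : s.Q.PosSemidef)
    (hR : s.R.PosDef) (hSigma0 : s.Sigma0.PosSemidef) :
    IsNonanticipative s N μ (loopInput s N.ordinary) := by
  have hadm : IsAdmissible s N (loopInput s N.ordinary) := isAdmissible_ordinary
  have hx0 : MemLp N.ordinary.x0 2 μ := memLp_x0 (N := N) hN hSigma0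
  refine ⟨fun k hk => (hadm k hk).mono (hadm.sigmaMeas_le_infoAlgebra hk.le).1 le_rfl,
    fun k _ => memLp_mulVec _ ?_⟩
  exact (PrivateLQG.memLp_loop (N' := N.ordinary) hx0
    (fun k => (isCenteredGaussian_of_hasLaw hQ (hN.law_w k)).memLp)
    (fun k => (isCenteredGaussian_of_hasLaw hR.posSemidef (hN.law_v k)).memLp)
    (fun _ => MemLp.zero) k).2.1

lemma memLp_deviation (hN : N.IsGaussian s SigmaDelta μ) (hQ : s.Q.PosSemidef)
    (hR : s.R.PosDef) (hSigma0 : s.Sigma0.PosSemidef) (hSigmaDelta : SigmaDelta.PosSemidef)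
    (k : ℕ) : MemLp (deviation s N k) 2 μ :=
  have h := hN.memLp_loop hQ hR hSigma0 hSigmaDelta k
  h.2.1.sub h.2.2

lemma loopState_sub_loopEst (k : ℕ) (ω : Ω) :
    loopState s N k ω - loopEst s N k ω = filterError s N k ω := by
  rw [loopState_eq_stateOf, loopEst_eq_estOf, stateOf_eq_estOf_add_filterError,
    add_sub_cancel_left]

lemma indep_filterError_sigmaInfo (hN : N.IsGaussian s SigmaDelta μ) (hQ : s.Q.PosSemidef)
    (hR : s.R.PosDef) (hSigma0 : s.Sigma0.PosSemidef) (k : ℕ) :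
    Indep (MeasurableSpace.comap (filterError s N k) inferInstance) (sigmaInfo s N k) μ :=
  indep_of_indep_of_le_right (filterError_gaussian_and_indep hN hQ hR hSigma0 k).2
    (sigmaInfo_le_infoAlgebra k)

/-- The error is independent of the information and centred, so that only the estimate survives
the conditioning. -/
lemma condExp_loopState (hN : N.IsGaussian s SigmaDelta μ) (hQ : s.Q.PosSemidef)
    (hR : s.R.PosDef) (hSigma0 : s.Sigma0.PosSemidef) (hSigmaDelta : SigmaDelta.PosSemidef)
    (k : ℕ) : μ[loopState s N k | sigmaInfo s N k] =ᵐ[μ] loopEst s N k := by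
  have hle : sigmaInfo s N k ≤ mΩ := (sigmaInfo_le_infoAlgebra k).trans (hN.infoAlgebra_le k)
  have he := (filterError_gaussian_and_indep hN hQ hR hSigma0 k).1
  have hest := (hN.memLp_loop hQ hR hSigma0 hSigmaDelta k).2.2.integrable one_le_two
  have hsum : loopState s N k = loopEst s N k + filterError s N k := by
    funext ω
    rw [Pi.add_apply, ← loopState_sub_loopEst, add_sub_cancel]
  have h1 : μ[loopEst s N k | sigmaInfo s N k] = loopEst s N k :=
    condExp_of_stronglyMeasurable hle (measurable_loopEst_sigmaInfo k).stronglyMeasurable hest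
  have h2 : μ[filterError s N k | sigmaInfo s N k] =ᵐ[μ] fun _ => ∫ ω, filterError s N k ω ∂μ :=
    condExp_indep_eq (hN.measurable_filterError k).comap_le hle
      (comap_measurable _).stronglyMeasurable (indep_filterError_sigmaInfo hN hQ hR hSigma0 k)
  have h3 : ∫ ω, filterError s N k ω ∂μ = 0 := by
    funext i
    rw [eval_integral fun i => he.gaussian.integrable.eval i, he.mean, Pi.zero_apply]
  rw [hsum]
  filter_upwards [condExp_add hest he.gaussian.integrable (sigmaInfo s N k), h2] with ω ha hb
  rw [ha, Pi.add_apply, h1, hb, h3, add_zero]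

lemma condExp_error_mul_error (hN : N.IsGaussian s SigmaDelta μ) (hQ : s.Q.PosSemidef)
    (hR : s.R.PosDef) (hSigma0 : s.Sigma0.PosSemidef) (k : ℕ) (i j : Fin n) :
    μ[fun ω => (loopState s N k ω i - loopEst s N k ω i) *
        (loopState s N k ω j - loopEst s N k ω j) | sigmaInfo s N k]
      =ᵐ[μ] fun _ => s.P k i j := by
  have hle : sigmaInfo s N k ≤ mΩ := (sigmaInfo_le_infoAlgebra k).trans (hN.infoAlgebra_le k)
  have he := (filterError_gaussian_and_indep hN hQ hR hSigma0 k).1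
  simp only [← Pi.sub_apply (loopState s N k _), loopState_sub_loopEst]
  have hmeas : Measurable[MeasurableSpace.comap (filterError s N k) inferInstance]
      fun ω => filterError s N k ω i * filterError s N k ω j :=
    ((measurable_pi_apply i).comp (comap_measurable (filterError s N k))).mul
      ((measurable_pi_apply j).comp (comap_measurable (filterError s N k)))
  have h := condExp_indep_eq (hN.measurable_filterError k).comap_le hle
    hmeas.stronglyMeasurable (indep_filterError_sigmaInfo hN hQ hR hSigma0 k)
  rwa [show ∫ ω, filterError s N k ω i * filterError s N k ω j ∂μ = s.P k i j from
    congrFun (congrFun he.moment i) j] at h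

lemma integral_loopPathCost (hN : N.IsGaussian s SigmaDelta μ) (hQ : s.Q.PosSemidef)
    (hR : s.R.PosDef) (hW : s.W.PosSemidef) (hU : s.U.PosDef) (hSigma0 : s.Sigma0.PosSemidef)
    (hSigmaDelta : SigmaDelta.PosSemidef) :
    Integrable (loopPathCost s N) μ ∧ loopCost s N μ = baseCost s N μ
      + ∑ k ∈ Finset.range s.T, (s.Phi k * devCov s N μ k).trace := by
  have h := pathCostOf_integral hN hQ hR hW hU hSigma0
    (isNonanticipative_loopInput hN hQ hR hSigma0 hSigmaDelta)
  rw [loopCost, loopPathCost_eq_pathCostOf]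
  refine ⟨h.1, h.2.trans ?_⟩
  congr 1
  refine Finset.sum_congr rfl fun k hk => ?_
  have hd := memLp_deviation hN hQ hR hSigma0 hSigmaDelta k
  simp only [controlGap_loopInput, System.dotProduct_inputWeight_L hU
    (System.posSemidef_S hW hU (Finset.mem_range.1 hk))]
  exact integral_dotProduct_mulVec _ hd hd

lemma isLeast_admissibleCosts (hN : N.IsGaussian s SigmaDelta μ) (hQ : s.Q.PosSemidef)
    (hR : s.R.PosDef) (hW : s.W.PosSemidef) (hU : s.U.PosDef) (hSigma0 : s.Sigma0.PosSemidef) :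
    IsLeast (admissibleCosts s N μ) (loopCost s N.ordinary μ) ∧
      loopCost s N.ordinary μ = baseCost s N μ := by
  have h := pathCostOf_integral hN hQ hR hW hU hSigma0
    (isNonanticipative_ordinary hN hQ hR hSigma0)
  have hcost : loopCost s N.ordinary μ = ∫ ω, pathCostOf s N (loopInput s N.ordinary) ω ∂μ := by
    rw [loopCost, loopPathCost_eq_pathCostOf, pathCostOf_ordinary]
  have hbase : loopCost s N.ordinary μ = baseCost s N μ := by
    rw [hcost, h.2]
    simp [controlGap_ordinary]
  refine ⟨⟨⟨_, isAdmissible_ordinary, h.1, hcost⟩, ?_⟩, hbase⟩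
  rintro _ ⟨u, hu, hint, rfl⟩
  rw [hbase]
  exact baseCost_le_of_isNonanticipative hN hQ hR hW hU hSigma0
    (hu.isNonanticipative hN hW hU hint)

lemma integral_trace_condDevCov (hN : N.IsGaussian s SigmaDelta μ) (k : ℕ)
    (M : Matrix (Fin n) (Fin n) ℝ) :
    Integrable (fun ω => (M * condDevCov s N μ k ω).trace) μ ∧
      (M * devCov s N μ k).trace = ∫ ω, (M * condDevCov s N μ k ω).trace ∂μ := by
  have hle : sigmaMeas (loopMeas s N) k ≤ mΩ :=
    (sigmaMeas_loopMeas_le_infoAlgebra k).trans (hN.infoAlgebra_le k)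
  have hint (i j : Fin n) : Integrable (fun ω => M i j * condDevCov s N μ k ω j i) μ :=
    integrable_condExp.const_mul _
  simp only [trace, diag_apply, Matrix.mul_apply]
  refine ⟨integrable_finsetSum _ fun i _ => integrable_finsetSum _ fun j _ => hint i j, ?_⟩
  rw [integral_finsetSum _ fun i _ => integrable_finsetSum _ fun j _ => hint i j]
  refine Finset.sum_congr rfl fun i _ => ?_
  rw [integral_finsetSum _ fun j _ => hint i j]
  refine Finset.sum_congr rfl fun j _ => ?_
  rw [integral_const_mul]
  simp only [condDevCov, devCov, of_apply]
  rw [integral_condExp hle]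

end Results

end PrivateLQG

theorem theorem3 {n m p : ℕ} (s : System n m p) (SigmaDelta : Matrix (Fin p) (Fin p) ℝ)
    (hT : 0 < s.T)
    (hQ : s.Q.PosSemidef) (hR : s.R.PosDef) (hW : s.W.PosSemidef) (hU : s.U.PosDef)
    (hSigma0 : s.Sigma0.PosSemidef) (hSigmaDelta : SigmaDelta.PosSemidef)
    {Ω : Type*} [MeasurableSpace Ω] (μ : Measure Ω) [IsProbabilityMeasure μ]
    (N : Noise Ω n p) (hN : N.IsGaussian s SigmaDelta μ) :
    -- the true estimate is the conditional mean of the state given the information at time `k`,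
    -- and `P k` is its conditional error covariance
    (∀ k ≤ s.T,
      μ[loopState s N k | sigmaInfo s N k] =ᵐ[μ] loopEst s N k ∧
      ∀ i j, μ[fun ω => (loopState s N k ω i - loopEst s N k ω i) *
          (loopState s N k ω j - loopEst s N k ω j) | sigmaInfo s N k]
        =ᵐ[μ] fun _ => s.P k i j) ∧
    -- the optimal cost is attained by the ordinary loop, and its value
    IsLeast (admissibleCosts s N μ) (loopCost s N.ordinary μ) ∧
    optimalCost s N μ =
      (∫ ω, N.x0 ω ⬝ᵥ s.S 0 *ᵥ N.x0 ω ∂μ)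
        + ∑ k ∈ Finset.range s.T, (s.S (k + 1) * s.Q).trace
        + ∑ k ∈ Finset.range s.T, (s.Phi k * s.P k).trace ∧
    -- the cost under the privacy scheme
    Integrable (loopPathCost s N) μ ∧
    loopCost s N μ =
      (∫ ω, N.x0 ω ⬝ᵥ s.S 0 *ᵥ N.x0 ω ∂μ)
        + ∑ k ∈ Finset.range s.T, (s.S (k + 1) * s.Q).trace
        + ∑ k ∈ Finset.range s.T, (s.Phi k * s.P k).trace
        + ∑ k ∈ Finset.range s.T, (s.Phi k * devCov s N μ k).trace ∧
    -- the extra term through the covariance conditional on the measurements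
    (∀ k < s.T, Integrable (fun ω => (s.Phi k * condDevCov s N μ k ω).trace) μ ∧
      (s.Phi k * devCov s N μ k).trace = ∫ ω, (s.Phi k * condDevCov s N μ k ω).trace ∂μ) ∧
    -- the service loss
    serviceLoss s N μ =
      (1 / (s.T : ℝ)) * ∑ k ∈ Finset.range s.T, (s.Phi k * devCov s N μ k).trace := by
  obtain ⟨hleast, hvalue⟩ := isLeast_admissibleCosts hN hQ hR hW hU hSigma0
  obtain ⟨hint, hcost⟩ := integral_loopPathCost hN hQ hR hW hU hSigma0 hSigmaDelta
  have hopt : optimalCost s N μ = baseCost s N μ := hleast.csInf_eq.trans hvalue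
  refine ⟨fun k _ => ⟨condExp_loopState hN hQ hR hSigma0 hSigmaDelta k,
    condExp_error_mul_error hN hQ hR hSigma0 k⟩, hleast, hopt, hint, hcost,
    fun k _ => integral_trace_condDevCov hN k (s.Phi k), ?_⟩
  rw [serviceLoss, hcost, hopt, add_sub_cancel_left]
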